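/- Let $\Sigma=\{0,1\}$. A binary function is a possibly partial function $\sigma:\Sigma^*\times\Sigma^*\to\Sigma^*$. A possibly partial function is polynomial-time computable if some deterministic Turing machine, running in time polynomial in the input length, outputs its value on each input in its domain and rejects every input outside its domain. We say that $\sigma$ is - *honest* if there is a polynomial $p$ such that every $z\in\mathrm{range}(\sigma)$ equals $\sigma(x,y)$ for some $(x,y)\in\mathrm{domain}(\sigma)$ with $|x|+|y|\le p(|z|)$; - *FP-invertible* if there is a total polynomial-time computable $g:\Sigma^*\to\Sigma^*\times\Sigma^*$ such that $\sigma(g(z))=z$ for every $z\in\mathrm{range}(\sigma)$; - *one-way* if it is honest, polynomial-time computable and not FP-invertible; - *strong* if neither of the following holds: (a) there is a total polynomial-time computable $g_1:\Sigma^*\times\Sigma^*\to\Sigma^*$ such that for all $x$ and $z$, if $\sigma(x,y)=z$ for some $y$, then $\sigma(x,g_1(x,z))=z$; (b) there is a total polynomial-time computable $g_2:\Sigma^*\times\Sigma^*\to\Sigma^*$ such that for all $y$ and $z$, if $\sigma(x,y)=z$ for some $x$, then $\sigma(g_2(y,z),y)=z$; - *total* if $\mathrm{domain}(\sigma)=\Sigma^*\times\Sigma^*$;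 - *commutative* if for all $x,y$ the values $\sigma(x,y)$ and $\sigma(y,x)$ are either both undefined, or both defined and equal; - *weakly associative* if $\sigma(x,\sigma(y,z))=\sigma(\sigma(x,y),z)$ for all $x,y,z$ such that $(x,y)$, $(y,z)$, $(x,\sigma(y,z))$ and $(\sigma(x,y),z)$ all lie in $\mathrm{domain}(\sigma)$; - *associative* if for all $x,y,z$ the expressions $\sigma(x,\sigma(y,z))$ and $\sigma(\sigma(x,y),z)$ are either both undefined, or both defined and equal (an expression with an undefined subexpression is undefined). An *AOWF* is an associative one-way function, and an *A$^w$OWF* is a weakly associative one-way function. **Theorem.** The following five statements are equivalent. 1. $\mathrm{P}\neq\mathrm{NP}$. 2. There exist A$^w$OWFs. 3. There exist AOWFs. 4. There exist strong, total, commutative A$^w$OWFs. 5. There exist strong, total, commutative AOWFs. -/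

import Mathlib

namespace AOWF

/-- Strings over the alphabet `{0, 1}`. -/
abbrev Str : Type := List Bool

/-! ### Polynomial time -/

/-- The pair `(x, y)` is presented to (or written by) a machine as `x # y`,
where `none` plays the role of the separator `#`. -/
def pairCode (q : Str × Str) : List (Option Bool) :=
  q.1.map some ++ none :: q.2.map some

/-- Output convention for machines that compute partial functions: the machine always halts;
it writes `1 w` if the value is defined and equal to `w`, and it rejects, by writing `0`,
if the value is undefined. -/
def partialCode : Option Str → List Bool
  | some w => true :: w
  | none => [false]

/-- `f` is computed, with respect to the given presentations of its inputs and outputs, by a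
(multi-stack) Turing machine whose number of steps is bounded by a polynomial in the length of the
input. -/
def PolyTime {α β A B : Type} (ea : α → List A) (eb : β → List B) (f : α → β) : Prop :=
  Nonempty (Turing.TM2ComputableInPolyTime ea eb f)

/-- The class P of languages that are decided in polynomial time. -/
def classP : Set (Set Str) :=
  {L | ∃ f : Str → Bool, PolyTime id Computability.encodeBool f ∧ ∀ x, x ∈ L ↔ f x = true}

/-- The class NP of languages that have a polynomial-time verifier with witnesses of polynomially
bounded length. -/
def classNP : Set (Set Str) :=
  {L | ∃ (R : Str × Str → Bool) (p : Polynomial ℕ), PolyTime pairCode Computability.encodeBool R ∧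
    ∀ x, x ∈ L ↔ ∃ w : Str, w.length ≤ p.eval x.length ∧ R (x, w) = true}

/-! ### Binary functions -/

/-- Possibly partial two-argument functions on strings; `none` means "undefined". -/
abbrev BinFun : Type := Str → Str → Option Str

/-- `(x, y)` belongs to the domain of `σ`. -/
def InDomain (σ : BinFun) (x y : Str) : Prop := ∃ z, σ x y = some z

/-- The range of `σ`. -/
def range (σ : BinFun) : Set Str := {z | ∃ x y, σ x y = some z}

/-- `σ` is defined everywhere. -/
def IsTotal (σ : BinFun) : Prop := ∀ x y, InDomain σ x y

/-- `σ` is a (possibly partial) polynomial-time computable binary function. -/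
def PolyTimeComputable (σ : BinFun) : Prop :=
  PolyTime pairCode partialCode (fun q : Str × Str => σ q.1 q.2)

/-- Every element of the range has a preimage of polynomially bounded size. -/
def IsHonest (σ : BinFun) : Prop :=
  ∃ p : Polynomial ℕ, ∀ z ∈ range σ,
    ∃ x y, σ x y = some z ∧ x.length + y.length ≤ p.eval z.length

/-- Some total polynomial-time computable function maps each element of the range of `σ`
to one of its preimages. -/
def IsFPInvertible (σ : BinFun) : Prop :=
  ∃ g : Str → Str × Str, PolyTime id pairCode g ∧
    ∀ z ∈ range σ, σ (g z).1 (g z).2 = some z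

/-- One-way functions, in the worst-case sense. -/
def IsOneWay (σ : BinFun) : Prop :=
  IsHonest σ ∧ PolyTimeComputable σ ∧ ¬ IsFPInvertible σ

/-- Some total polynomial-time computable function, given the first argument `x` and a value `z`,
finds a matching second argument whenever there is one. -/
def IsFPInvertibleGivenFst (σ : BinFun) : Prop :=
  ∃ g : Str × Str → Str, PolyTime pairCode id g ∧
    ∀ z ∈ range σ, ∀ x, (∃ y, σ x y = some z) → σ x (g (x, z)) = some z

/-- Some total polynomial-time computable function, given the second argument `y` and a value `z`,
finds a matching first argument whenever there is one. -/
def IsFPInvertibleGivenSnd (σ : BinFun) : Prop :=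
  ∃ g : Str × Str → Str, PolyTime pairCode id g ∧
    ∀ z ∈ range σ, ∀ y, (∃ x, σ x y = some z) → σ (g (y, z)) y = some z

/-- `σ` cannot be inverted in polynomial time even if one of its arguments is given. -/
def IsStrong (σ : BinFun) : Prop :=
  ¬ IsFPInvertibleGivenFst σ ∧ ¬ IsFPInvertibleGivenSnd σ

/-- Weak associativity: the associative law holds wherever all four applications of `σ` are
defined. -/
def IsWeaklyAssociative (σ : BinFun) : Prop :=
  ∀ x y z xy yz u v : Str, σ x y = some xy → σ y z = some yz →
    σ x yz = some u → σ xy z = some v → u = v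

/-- The extension of `σ` to strings together with the extra value `⊥`, represented by `none`. -/
def extend (σ : BinFun) : Option Str → Option Str → Option Str
  | some a, some b => σ a b
  | _, _ => none

/-- Associativity in the sense of complete equality: both sides are undefined, or both are defined
and equal. -/
def IsAssociative (σ : BinFun) : Prop :=
  ∀ x y z : Str, extend σ (extend σ (some x) (some y)) (some z) =
    extend σ (some x) (extend σ (some y) (some z))

/-- Commutativity in the sense of complete equality. -/
def IsCommutative (σ : BinFun) : Prop :=
  ∀ x y : Str, extend σ (some x) (some y) = extend σ (some y) (some x)

/-- Associative one-way functions. -/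
def IsAOWF (σ : BinFun) : Prop := IsAssociative σ ∧ IsOneWay σ

/-- Weakly associative one-way functions. -/
def IsAwOWF (σ : BinFun) : Prop := IsWeaklyAssociative σ ∧ IsOneWay σ

end AOWF

/-! Let `L` be in NP but not in P, with verifier `V`. Call `1x` a query and `01w` a witness. The
product of a query `1x` and a witness `01w`, in either order, is `00x` if `V` accepts `(x, w)`;
every other product is the empty word. Products are empty or begin with `00`, so they are neither
queries nor witnesses, and a product with a factor that is itself a product is empty. Both sides of
the associative law are therefore empty (`product_product`), and commutativity is built in. A
preimage of `00x` contains a witness for `x`, even if `1x` is already given. Inversion in any of the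
three senses would thus find witnesses in polynomial time and put `L` into P
(`mem_classP_of_findWitness`). Honesty holds because witnesses are short.

Conversely, if P = NP, every honest polynomial-time function can be inverted, associative or not.
Whether a prefix extends to the code of a short preimage is an NP question, and a polynomial-time
answer to it lets a preimage be built letter by letter (`iterate_searchStep`). The remaining
implications drop conditions, as associativity implies weak associativity.

Most of the work goes into showing that these algorithms run in polynomial time on stack machines.
Machines are needed only for finite transducers, composition, pairing and iteration with bounded
intermediate lengths; everything else is assembled from these. -/

namespace AOWF

open Turing Function

/-! ### Runs of stack machines -/

section Reach

variable {K : Type} [DecidableEq K] {Γ : K → Type} {Λ σ : Type}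

/-- `Reach m t c d`: the machine `m` gets from `c` to `d` in at most `t` steps. -/
inductive Reach (m : Λ → TM2.Stmt Γ Λ σ) : ℕ → TM2.Cfg Γ Λ σ → TM2.Cfg Γ Λ σ → Prop
  | refl (t : ℕ) (c : TM2.Cfg Γ Λ σ) : Reach m t c c
  | head {t : ℕ} {c d e : TM2.Cfg Γ Λ σ} :
      TM2.step m c = some d → Reach m t d e → Reach m (t + 1) c e

variable {m : Λ → TM2.Stmt Γ Λ σ} {c d e : TM2.Cfg Γ Λ σ} {s t : ℕ}

theorem Reach.mono (h : Reach m s c d) (hst : s ≤ t) : Reach m t c d := by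
  induction h generalizing t with
  | refl => exact .refl _ _
  | head h _ ih =>
    obtain ⟨t, rfl⟩ : ∃ t', t = t' + 1 := ⟨t - 1, by omega⟩
    exact .head h (ih (by omega))

theorem Reach.trans (h : Reach m s c d) (h' : Reach m t d e) : Reach m (s + t) c e := by
  induction h with
  | refl => exact h'.mono (by omega)
  | head h _ ih => exact (Reach.head h (ih h')).mono (by omega)

theorem Reach.single (h : TM2.step m c = some d) : Reach m 1 c d := .head h (.refl 0 d)

theorem Reach.exists_iterate (h : Reach m t c d) :
    ∃ n ≤ t, (flip bind (TM2.step m))^[n] (some c) = some d := by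
  induction h with
  | refl => exact ⟨0, by omega, rfl⟩
  | @head t c d e h _ ih =>
    obtain ⟨n, hn, h'⟩ := ih
    refine ⟨n + 1, by omega, ?_⟩
    rw [iterate_succ_apply]
    simpa only [flip, Option.bind_eq_bind, Option.bind_some, h] using h'

theorem iterate_step_none (n : ℕ) : (flip bind (TM2.step m))^[n] none = none := by
  induction n with
  | zero => rfl
  | succ n ih => rw [iterate_succ_apply]; exact ih

theorem Reach.of_iterate {n : ℕ} (h : (flip bind (TM2.step m))^[n] (some c) = some d) :
    Reach m n c d := by
  induction n generalizing c with
  | zero =>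
    cases h
    exact .refl _ _
  | succ n ih =>
    rw [iterate_succ_apply] at h
    cases hc : TM2.step m c with
    | none =>
      simp only [flip, Option.bind_eq_bind, Option.bind_some, hc] at h
      exact absurd (h.symm.trans (iterate_step_none n)) (by simp)
    | some c' =>
      simp only [flip, Option.bind_eq_bind, Option.bind_some, hc] at h
      exact .head hc (ih h)

/-- A loop that consumes one letter per step. -/
theorem Reach.loop {α : Type} (F : List α → List α → TM2.Cfg Γ Λ σ)
    (h : ∀ d a l, TM2.step m (F d (a :: l)) = some (F (a :: d) l)) (d l : List α) :
    Reach m l.length (F d l) (F (l.reverse ++ d) []) := by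
  induction l generalizing d with
  | nil => exact .refl _ _
  | cons a l ih => simpa using Reach.head (h d a l) (ih (a :: d))

/-- The number of letters that a statement can push. -/
def pushBound : TM2.Stmt Γ Λ σ → ℕ
  | .push _ _ q => pushBound q + 1
  | .peek _ _ q => pushBound q
  | .pop _ _ q => pushBound q
  | .load _ q => pushBound q
  | .branch _ q q' => pushBound q + pushBound q'
  | .goto _ => 0
  | .halt => 0

theorem length_stepAux (q : TM2.Stmt Γ Λ σ) (v : σ) (S : ∀ k, List (Γ k)) (k : K) :
    ((TM2.stepAux q v S).stk k).length ≤ (S k).length + pushBound q := by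
  induction q generalizing v S with
  | push k' f q ih =>
    refine (ih _ _).trans ?_
    by_cases h : k = k'
    · subst h; simp [pushBound]
      omega
    · simp [pushBound, h]
  | peek k' f q ih => exact ih _ _
  | pop k' f q ih =>
    refine (ih _ _).trans ?_
    by_cases h : k = k'
    · subst h; simp [pushBound]
    · simp [pushBound, h]
  | load f q ih => exact ih _ _
  | branch f q q' ih ih' =>
    cases h : f v
    · have := ih' v S
      simp only [TM2.stepAux, h, cond_false, pushBound]; omega
    · have := ih v S
      simp only [TM2.stepAux, h, cond_true, pushBound]; omega
  | goto f => simp [pushBound]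
  | halt => simp [pushBound]

/-- One step pushes no more letters than its statement contains pushes, and the sum over all labels
bounds this uniformly. Hence polynomial time forces polynomially long outputs, which compositions
rely on. -/
theorem Reach.length_le [Fintype Λ] (h : Reach m t c d) (k : K) :
    (d.stk k).length ≤ (c.stk k).length + t * ∑ l, pushBound (m l) := by
  induction h with
  | refl => omega
  | @head t c d e h _ ih =>
    obtain ⟨_ | l, v, S⟩ := c
    · simp at h
    · simp only [TM2.step, Option.some.injEq] at h
      have h1 := length_stepAux (m l) v S k
      rw [h] at h1
      have h2 : pushBound (m l) ≤ ∑ l, pushBound (m l) :=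
        Finset.single_le_sum (f := fun l => pushBound (m l)) (by simp) (Finset.mem_univ l)
      have h3 : (t + 1) * ∑ l, pushBound (m l)
        = t * ∑ l, pushBound (m l) + ∑ l, pushBound (m l) := by ring
      show (e.stk k).length ≤ (S k).length + _
      omega

end Reach

/-! ### Polynomial bounds and polynomial time -/

/-- The stacks that are all empty, with the exception of one. -/
def single {K : Type} [DecidableEq K] {Γ : K → Type} (k : K) (l : List (Γ k)) :
    ∀ k, List (Γ k) :=
  update (fun _ => []) k l

theorem initList_eq (tm : FinTM2) (l : List (tm.Γ tm.k₀)) :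
    initList tm l = ⟨some tm.main, tm.initialState, single tm.k₀ l⟩ := by
  unfold initList single
  congr 1
  funext k
  by_cases h : k = tm.k₀
  · subst h; simp
  · simp [h]

theorem haltList_eq (tm : FinTM2) (l : List (tm.Γ tm.k₁)) :
    haltList tm l = ⟨none, tm.initialState, single tm.k₁ l⟩ := by
  unfold haltList single
  congr 1
  funext k
  by_cases h : k = tm.k₁
  · subst h; simp
  · simp [h]

/-- The working form of `PolyTime`. A halted machine is back in its initial internal state, with all
stacks but the output stack empty; this is what allows a machine to be called repeatedly. -/
theorem polyTime_iff {α β A B : Type} {ea : α → List A} {eb : β → List B} {f : α → β} :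
    PolyTime ea eb f ↔ ∃ (tm : FinTM2) (i : tm.Γ tm.k₀ ≃ A) (o : tm.Γ tm.k₁ ≃ B)
      (p : Polynomial ℕ), ∀ a, Reach tm.m (p.eval (ea a).length)
        ⟨some tm.main, tm.initialState, single tm.k₀ ((ea a).map i.symm)⟩
        ⟨none, tm.initialState, single tm.k₁ ((eb (f a)).map o.symm)⟩ := by
  constructor
  · rintro ⟨⟨⟨tm, i, o⟩, p, h⟩⟩
    refine ⟨tm, i, o, p, fun a => ?_⟩
    obtain ⟨⟨n, hn⟩, hle⟩ := h a
    rw [initList_eq, Option.map_some, haltList_eq] at hn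
    exact (Reach.of_iterate hn).mono hle
  · rintro ⟨tm, i, o, p, h⟩
    refine ⟨⟨⟨tm, i, o⟩, p, fun a => Classical.choice ?_⟩⟩
    obtain ⟨n, hn, h'⟩ := (h a).exists_iterate
    refine ⟨⟨⟨n, ?_⟩, hn⟩⟩
    rw [initList_eq, Option.map_some, haltList_eq]
    exact h'

/-- Boundedness by a polynomial. -/
def PolyBdd (f : ℕ → ℕ) : Prop := ∃ p : Polynomial ℕ, ∀ n, f n ≤ p.eval n

theorem eval_mono (p : Polynomial ℕ) : Monotone fun n => p.eval n := fun a b h => by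
  simp only [Polynomial.eval_eq_sum, Polynomial.sum]
  exact Finset.sum_le_sum fun i _ => Nat.mul_le_mul_left _ (Nat.pow_le_pow_left h i)

theorem PolyBdd.eval (p : Polynomial ℕ) : PolyBdd fun n => p.eval n := ⟨p, fun _ => le_rfl⟩

theorem PolyBdd.const (c : ℕ) : PolyBdd fun _ => c := ⟨.C c, by simp⟩

theorem PolyBdd.id : PolyBdd fun n => n := ⟨.X, by simp⟩

theorem PolyBdd.add {f g : ℕ → ℕ} (hf : PolyBdd f) (hg : PolyBdd g) :
    PolyBdd fun n => f n + g n := by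
  obtain ⟨p, hp⟩ := hf
  obtain ⟨q, hq⟩ := hg
  exact ⟨p + q, fun n => by simpa using add_le_add (hp n) (hq n)⟩

theorem PolyBdd.mul {f g : ℕ → ℕ} (hf : PolyBdd f) (hg : PolyBdd g) :
    PolyBdd fun n => f n * g n := by
  obtain ⟨p, hp⟩ := hf
  obtain ⟨q, hq⟩ := hg
  exact ⟨p * q, fun n => by simpa using Nat.mul_le_mul (hp n) (hq n)⟩

theorem PolyBdd.comp {g : ℕ → ℕ} (p : Polynomial ℕ) (hg : PolyBdd g) :
    PolyBdd fun n => p.eval (g n) := by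
  obtain ⟨q, hq⟩ := hg
  exact ⟨p.comp q, fun n => by simpa using eval_mono p (hq n)⟩

/-- A machine with exact time bound replaced by a polynomially bounded one. -/
theorem PolyTime.intro {α β A B : Type} {ea : α → List A} {eb : β → List B} {f : α → β}
    (tm : FinTM2) (i : tm.Γ tm.k₀ ≃ A) (o : tm.Γ tm.k₁ ≃ B) {T : ℕ → ℕ} (hT : PolyBdd T)
    (h : ∀ a, Reach tm.m (T (ea a).length)
        ⟨some tm.main, tm.initialState, single tm.k₀ ((ea a).map i.symm)⟩
        ⟨none, tm.initialState, single tm.k₁ ((eb (f a)).map o.symm)⟩) : PolyTime ea eb f := by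
  obtain ⟨p, hp⟩ := hT
  exact polyTime_iff.2 ⟨tm, i, o, p, fun a => (h a).mono (hp _)⟩

theorem PolyTime.length_le {α β A B : Type} {ea : α → List A} {eb : β → List B} {f : α → β}
    (h : PolyTime ea eb f) : ∃ p : Polynomial ℕ, ∀ a, (eb (f a)).length ≤ p.eval (ea a).length := by
  obtain ⟨tm, i, o, p, h⟩ := polyTime_iff.1 h
  have := tm.ΛFin
  obtain ⟨q, hq⟩ : PolyBdd fun n => n + p.eval n * ∑ l, pushBound (tm.m l) :=
    PolyBdd.id.add ((PolyBdd.eval p).mul (PolyBdd.const _))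
  refine ⟨q, fun a => le_trans ?_ (hq _)⟩
  have h1 := (h a).length_le tm.k₁
  have h2 : (single tm.k₀ ((ea a).map i.symm) tm.k₁).length ≤ (ea a).length := by
    unfold single
    by_cases h : tm.k₁ = tm.k₀
    -- The alphabet depends on the stack, so the equation can be substituted only once one side is a
    -- variable.
    · generalize tm.k₁ = k at h
      subst h; simp
    · simp [h]
  have h3 : (single tm.k₁ ((eb (f a)).map o.symm) tm.k₁).length = (eb (f a)).length := by
    simp [single]
  simp only [h3] at h1
  exact h1.trans (by simpa using h2)

/-- A machine sees only codes; the values of `F` on words that code nothing are irrelevant. -/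
theorem PolyTime.recode {α β A B : Type} {ea : α → List A} {eb : β → List B} {f : α → β}
    {F : List A → List B} (hF : PolyTime id id F) (h : ∀ a, eb (f a) = F (ea a)) :
    PolyTime ea eb f := by
  obtain ⟨tm, i, o, p, hp⟩ := polyTime_iff.1 hF
  refine polyTime_iff.2 ⟨tm, i, o, p, fun a => ?_⟩
  rw [h]
  exact hp (ea a)

/-! ### Machines that call other machines -/

namespace Frame

variable {I : Type} (M : I → FinTM2) (A L : Type)

/-- Three stacks over `A` of its own and the stacks of all the machines `M i`. -/
abbrev K : Type := Fin 3 ⊕ Σ i, (M i).K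

/-- The alphabets. -/
abbrev Γ : K M → Type
  | .inl _ => A
  | .inr p => (M p.1).Γ p.2

/-- The internal states. -/
abbrev St : Type := Option A × ∀ i, (M i).σ

/-- The labels. -/
abbrev Lab : Type := L ⊕ Σ i, (M i).Λ

variable {M A L}

/-- Combination of the stacks. -/
def store (s : Fin 3 → List A) (T : ∀ i k, List ((M i).Γ k)) : ∀ k, List (Γ M A k)
  | .inl u => s u
  | .inr p => T p.1 p.2

@[simp] theorem store_inl (s : Fin 3 → List A) (T : ∀ i k, List ((M i).Γ k)) (u : Fin 3) :
    store s T (.inl u) = s u := rfl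

@[simp] theorem store_inr (s : Fin 3 → List A) (T : ∀ i k, List ((M i).Γ k)) (i : I) (k : (M i).K) :
    store s T (.inr ⟨i, k⟩) = T i k := rfl

@[simp] theorem update_store_inl (s : Fin 3 → List A) (T : ∀ i k, List ((M i).Γ k)) (u : Fin 3)
    [DecidableEq I] (l : List A) : update (store s T) (.inl u) l = store (update s u l) T := by
  funext k
  rcases k with v | p
  · by_cases h : v = u
    · subst h; simp
    · simp [h]
  · simp [store]

@[simp] theorem update_store_inr [DecidableEq I] (s : Fin 3 → List A) (T : ∀ i k, List ((M i).Γ k)) (i : I)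
    (k : (M i).K) (l : List ((M i).Γ k)) :
    update (store s T) (.inr ⟨i, k⟩) l = store s (update T i (update (T i) k l)) := by
  funext k'
  rcases k' with v | ⟨j, k'⟩
  · simp
  · by_cases h : j = i
    · subst h
      by_cases h : k' = k
      · subst h; simp
      · simp [h]
    · simp [h]

variable [DecidableEq I]

/-- The statement `q` of the machine `M i`, with a jump to `ret` in place of halting. -/
def lift (i : I) (ret : L) :
    TM2.Stmt (M i).Γ (M i).Λ (M i).σ → TM2.Stmt (Γ M A) (Lab M L) (St M A)
  | .push k f q => .push (.inr ⟨i, k⟩) (fun v => f (v.2 i)) (lift i ret q)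
  | .peek k f q =>
    .peek (.inr ⟨i, k⟩) (fun v a => (v.1, update v.2 i (f (v.2 i) a))) (lift i ret q)
  | .pop k f q =>
    .pop (.inr ⟨i, k⟩) (fun v a => (v.1, update v.2 i (f (v.2 i) a))) (lift i ret q)
  | .load f q => .load (fun v => (v.1, update v.2 i (f (v.2 i)))) (lift i ret q)
  | .branch f q q' => .branch (fun v => f (v.2 i)) (lift i ret q) (lift i ret q')
  | .goto f => .goto fun v => .inr ⟨i, f (v.2 i)⟩
  | .halt => .goto fun _ => .inl ret

/-- The program: own code `m`, and control passes to `ret i` when `M i` halts. -/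
def prog (m : L → TM2.Stmt (Γ M A) (Lab M L) (St M A)) (ret : I → L) :
    Lab M L → TM2.Stmt (Γ M A) (Lab M L) (St M A)
  | .inl l => m l
  | .inr p => lift p.1 (ret p.1) ((M p.1).m p.2)

/-- A configuration of `M i` as part of a configuration of the whole machine. -/
def embed (i : I) (ret : L) (x : Option A) (w : ∀ i, (M i).σ) (s : Fin 3 → List A)
    (T : ∀ i k, List ((M i).Γ k)) (c : TM2.Cfg (M i).Γ (M i).Λ (M i).σ) :
    TM2.Cfg (Γ M A) (Lab M L) (St M A) :=
  ⟨some (c.l.elim (.inl ret) fun l => .inr ⟨i, l⟩), (x, update w i c.var),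
    store s (update T i c.stk)⟩

/-- The lifted statement touches only the state and the stacks of `M i`, and `embed` represents a
halted configuration by the label `ret`. -/
theorem stepAux_lift (i : I) (ret : L) (x : Option A) (w : ∀ i, (M i).σ) (s : Fin 3 → List A)
    (T : ∀ i k, List ((M i).Γ k)) (q : TM2.Stmt (M i).Γ (M i).Λ (M i).σ) (v : (M i).σ)
    (S : ∀ k, List ((M i).Γ k)) :
    TM2.stepAux (lift i ret q) (x, update w i v) (store s (update T i S)) =
      embed i ret x w s T (TM2.stepAux q v S) := by
  induction q generalizing v S with
  | push k f q ih => simp [lift, ← ih]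
  | peek k f q ih => simp [lift, ← ih]
  | pop k f q ih => simp [lift, ← ih]
  | load f q ih => simp [lift, ← ih]
  | branch f q q' ih ih' => cases h : f v <;> simp [lift, h, ih, ih']
  | goto f => simp [lift, embed]
  | halt => simp [lift, embed]

/-- The simulation is step for step, so the time bound is unchanged: the halting step becomes the
jump to `ret i`. -/
theorem reach_embed {m : L → TM2.Stmt (Γ M A) (Lab M L) (St M A)} {ret : I → L} {i : I}
    (x : Option A) (w : ∀ i, (M i).σ) (s : Fin 3 → List A) (T : ∀ i k, List ((M i).Γ k)) {t : ℕ}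
    {c d : TM2.Cfg (M i).Γ (M i).Λ (M i).σ} (h : Reach (M i).m t c d) :
    Reach (prog m ret) t (embed i (ret i) x w s T c) (embed i (ret i) x w s T d) := by
  induction h with
  | refl => exact .refl _ _
  | @head t c d e h _ ih =>
    refine .head ?_ ih
    obtain ⟨_ | l, v, S⟩ := c
    · simp at h
    · simp only [TM2.step, Option.some.injEq] at h
      rw [← h, ← stepAux_lift]
      rfl

end Frame

instance (tm : FinTM2) : Fintype tm.K := tm.kFin
instance (tm : FinTM2) : Fintype tm.Λ := tm.ΛFin
instance (tm : FinTM2) : Fintype tm.σ := tm.σFin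

namespace Frame

variable {I : Type} [DecidableEq I] {M : I → FinTM2} {A L : Type}

/-- All stacks of the machines `M i` empty. -/
abbrev empty : ∀ i k, List ((M i).Γ k) := fun _ _ => []

/-- All stacks of the machines `M i` empty, except for one. -/
def only (i : I) (k : (M i).K) (l : List ((M i).Γ k)) : ∀ i k, List ((M i).Γ k) :=
  update empty i (single k l)

@[simp] theorem only_self (i : I) (k : (M i).K) (l : List ((M i).Γ k)) : only i k l i k = l := by
  simp [only, single]

@[simp] theorem update_only (i : I) (k : (M i).K) (l l' : List ((M i).Γ k)) :
    update (only i k l) i (update (only i k l i) k l') = only i k l' := by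
  simp [only, single]

@[simp] theorem only_nil (i : I) (k : (M i).K) : only i k ([] : List ((M i).Γ k)) = empty := by
  simp [only, single]

/-- Configuration with clean internal state. -/
abbrev cfg (l : Option (Lab M L)) (s : Fin 3 → List A) (T : ∀ i k, List ((M i).Γ k)) :
    TM2.Cfg (Γ M A) (Lab M L) (St M A) :=
  ⟨l, (none, fun i => (M i).initialState), store s T⟩

theorem store_empty (l : List A) :
    store (M := M) ![l, [], []] empty = single (.inl 0) l := by
  funext k
  rcases k with v | p
  · fin_cases v <;> simp [single]
  · simp [single, store]

theorem store_only (i : I) (k : (M i).K) (l : List ((M i).Γ k)) :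
    store (A := A) (fun _ => []) (only i k l) = single (.inr ⟨i, k⟩) l := by
  have : store (M := M) (A := A) (fun _ => []) empty = fun _ => [] := by
    funext k
    rcases k with v | p <;> rfl
  rw [single, ← this, update_store_inr]
  rfl

/-- A loop that empties the stack `k`. -/
def drain (k : K M) (ψ : Γ M A k → A)
    (body : TM2.Stmt (Γ M A) (Lab M L) (St M A) → TM2.Stmt (Γ M A) (Lab M L) (St M A)) (self : L)
    (next : TM2.Stmt (Γ M A) (Lab M L) (St M A)) : TM2.Stmt (Γ M A) (Lab M L) (St M A) :=
  .pop k (fun v a => (a.map ψ, v.2)) <| .branch (fun v => v.1.isSome)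
    -- The letter just read is forgotten, so that every round starts from the clean internal state
    -- of `cfg`.
    (body <| .load (fun v => (none, v.2)) <| .goto fun _ => .inl self) next

variable {m : L → TM2.Stmt (Γ M A) (Lab M L) (St M A)} {ret : I → L}

theorem reach_run (i : I) (s : Fin 3 → List A) {t : ℕ} {x : List ((M i).Γ (M i).k₀)}
    {y : List ((M i).Γ (M i).k₁)}
    (h : Reach (M i).m t ⟨some (M i).main, (M i).initialState, single (M i).k₀ x⟩
      ⟨none, (M i).initialState, single (M i).k₁ y⟩) :
    Reach (prog m ret) t (cfg (some (.inr ⟨i, (M i).main⟩)) s (only i (M i).k₀ x))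
      (cfg (some (.inl (ret i))) s (only i (M i).k₁ y)) := by
  have := reach_embed (m := m) (ret := ret) none (fun i => (M i).initialState) s empty h
  simpa [embed, only] using this

variable [Inhabited A]

/-- Move the content of the own stack `u` to the input stack of `M i`, then run `M i`. -/
def load (u : Fin 3) (i : I) (φ : A → (M i).Γ (M i).k₀) (self : L) :
    TM2.Stmt (Γ M A) (Lab M L) (St M A) :=
  drain (.inl u) (fun a => a) (.push (.inr ⟨i, (M i).k₀⟩) fun v => φ (v.1.getD default)) self
    (.goto fun _ => .inr ⟨i, (M i).main⟩)

/-- Move the output of `M i` to the own stack `u`. -/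
def unload (u : Fin 3) (i : I) (ψ : (M i).Γ (M i).k₁ → A) (self next : L) :
    TM2.Stmt (Γ M A) (Lab M L) (St M A) :=
  drain (.inr ⟨i, (M i).k₁⟩) ψ (.push (.inl u) fun v => v.1.getD default) self
    (.goto fun _ => .inl next)

/-- Moving a word from stack to stack reverses it. The extra step is the pop that finds the stack
empty. -/
theorem reach_load {u : Fin 3} {i : I} {φ : A → (M i).Γ (M i).k₀} {self : L}
    (hm : m self = load u i φ self) (s : Fin 3 → List A) :
    Reach (prog m ret) ((s u).length + 1) (cfg (some (.inl self)) s empty)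
      (cfg (some (.inr ⟨i, (M i).main⟩)) (update s u [])
        (only i (M i).k₀ ((s u).reverse.map φ))) := by
  have := Reach.loop (m := prog m ret) (fun d l => cfg (some (.inl self)) (update s u l)
    (only i (M i).k₀ (d.map φ))) (fun d a l => by
      simp [prog, hm, load, drain]) [] (s u)
  refine Reach.trans (c := cfg (some (.inl self)) s empty) (by simpa using this) (.single ?_)
  simp [prog, hm, load, drain]

theorem reach_unload {u : Fin 3} {i : I} {ψ : (M i).Γ (M i).k₁ → A} {self next : L}
    (hm : m self = unload u i ψ self next) (s : Fin 3 → List A) (hs : s u = [])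
    (y : List ((M i).Γ (M i).k₁)) :
    Reach (prog m ret) (y.length + 1) (cfg (some (.inl self)) s (only i (M i).k₁ y))
      (cfg (some (.inl next)) (update s u (y.reverse.map ψ)) empty) := by
  have := Reach.loop (m := prog m ret) (fun d l => cfg (some (.inl self)) (update s u (d.map ψ))
    (only i (M i).k₁ l)) (fun d a l => by
      simp [prog, hm, unload, drain]) [] y
  refine Reach.trans (c := cfg (some (.inl self)) s (only i (M i).k₁ y))
    (by simpa [← hs] using this) (.single ?_)
  simp [prog, hm, unload, drain]

end Frame

namespace Frame

variable {I : Type} [DecidableEq I] {M : I → FinTM2} {A L : Type}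

/-- The bundled machine. -/
def machine [Fintype I] [Fintype A] [Fintype L] (m : L → TM2.Stmt (Γ M A) (Lab M L) (St M A))
    (ret : I → L) (start : Lab M L) (k₀ k₁ : K M) [Fintype (Γ M A k₀)] : FinTM2 where
  K := K M
  k₀ := k₀
  k₁ := k₁
  Γ := Γ M A
  Λ := Lab M L
  main := start
  σ := St M A
  initialState := (none, fun i => (M i).initialState)
  m := prog m ret

@[simp] theorem update_zero (x y z a : List A) : update ![x, y, z] 0 a = ![a, y, z] := by
  funext u; fin_cases u <;> rfl

@[simp] theorem update_one (x y z a : List A) : update ![x, y, z] 1 a = ![x, a, z] := by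
  funext u; fin_cases u <;> rfl

@[simp] theorem update_two (x y z a : List A) : update ![x, y, z] 2 a = ![x, y, a] := by
  funext u; fin_cases u <;> rfl

end Frame

/-! ### Composition, pairing and iteration in polynomial time -/

open AOWF.Frame

/-- Labels of the machine for compositions. -/
inductive CompLabel
  | unload | load | done
  deriving DecidableEq

instance : Fintype CompLabel := ⟨{.unload, .load, .done}, by rintro ⟨⟩ <;> simp⟩

/-- The intermediate word passes through an own stack, and the two reversals cancel. It has length
at most `r.eval n`, so monotonicity of `q` bounds the second run by `q.eval (r.eval n)`. -/
theorem PolyTime.comp {α β γ A B C : Type} [Fintype B] [Inhabited B] {ea : α → List A}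
    {eb : β → List B} {ec : γ → List C} {g : β → γ} {f : α → β} (hg : PolyTime eb ec g)
    (hf : PolyTime ea eb f) : PolyTime ea ec fun a => g (f a) := by
  obtain ⟨r, hr⟩ := hf.length_le
  obtain ⟨N, i₁, o₁, p, hf⟩ := polyTime_iff.1 hf
  obtain ⟨N', i₂, o₂, q, hg⟩ := polyTime_iff.1 hg
  let M : Bool → FinTM2 := fun b => cond b N' N
  let m : CompLabel → TM2.Stmt (Γ M B) (Lab M CompLabel) (St M B)
    | .unload => unload (M := M) 0 false o₁ .unload .load
    | .load => load (M := M) 0 true i₂.symm .load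
    | .done => .halt
  let ret : Bool → CompLabel := fun b => cond b .done .unload
  have : Fintype (Γ M B (.inr ⟨false, N.k₀⟩)) := N.Γk₀Fin
  refine PolyTime.intro (machine (M := M) m ret (.inr ⟨false, N.main⟩) (.inr ⟨false, N.k₀⟩)
    (.inr ⟨true, N'.k₁⟩)) i₁ o₂ (T := fun n => p.eval n + (r.eval n + 1) + (r.eval n + 1) +
      q.eval (r.eval n) + 1) ?_ fun a => ?_
  · exact ((((PolyBdd.eval _).add ((PolyBdd.eval _).add (.const _))).add
      ((PolyBdd.eval _).add (.const _))).add ((PolyBdd.eval _).comp _)).add (.const _)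
  have h1 := reach_run (M := M) (m := m) (ret := ret) (A := B) false (fun _ => []) (hf a)
  have h2 := reach_unload (M := M) (m := m) (ret := ret) (A := B) (i := false) (u := 0) (ψ := o₁)
    (self := .unload) (next := .load) rfl (fun _ => []) rfl ((eb (f a)).map o₁.symm)
  have h3 := reach_load (M := M) (m := m) (ret := ret) (A := B) (i := true) (u := 0)
    (φ := i₂.symm) (self := .load) rfl (update (fun _ => []) 0 (eb (f a)).reverse)
  have h4 := reach_run (M := M) (m := m) (ret := ret) (A := B) true (fun _ => []) (hg (f a))
  have e : update (fun _ : Fin 3 => ([] : List B)) 0 [] = fun _ => [] := by simp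
  simp only [update_self, update_idem, List.reverse_reverse, e, List.length_reverse] at h3
  simp only [← List.map_reverse, List.map_map, Equiv.self_comp_symm, List.map_id,
    List.length_map] at h2
  have h5 := ((h1.trans h2).trans h3).trans h4 |>.trans (.single rfl)
  simp only [cfg, store_only] at h5
  refine h5.mono ?_
  have := hr a
  have := eval_mono q (hr a)
  simp only at this
  omega


/-- Doubling: each letter is preceded by a marker. -/
def dbl (s : Str) : Str := s.flatMap fun b => [true, b]

@[simp] theorem dbl_nil : dbl [] = [] := rfl

@[simp] theorem dbl_cons (b : Bool) (s : Str) : dbl (b :: s) = true :: b :: dbl s := rfl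

/-- Pairs of strings, coded as strings. -/
def enc (q : Str × Str) : Str := dbl q.1 ++ false :: q.2

@[simp] theorem length_dbl (s : Str) : (dbl s).length = 2 * s.length := by
  induction s with
  | nil => rfl
  | cons b s ih => simp [ih]; ring

@[simp] theorem length_enc (q : Str × Str) :
    (enc q).length = 2 * q.1.length + q.2.length + 1 := by
  simp [enc]; ring

/-- Labels of the machine for pairs. -/
inductive PairLabel
  | copy | load (i : Bool) | unload (i : Bool) | emit | emitDbl
  deriving DecidableEq

instance : Fintype PairLabel :=
  ⟨{.copy, .load true, .load false, .unload true, .unload false, .emit, .emitDbl}, by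
    rintro (_ | (_ | _) | (_ | _) | _ | _) <;> simp⟩

/-- Running `M i`, which computes `f`, on the content of an own stack, read from its bottom. -/
theorem Frame.reach_call {I : Type} [DecidableEq I] {M : I → FinTM2} {L : Type}
    {m : L → TM2.Stmt (Γ M Bool) (Lab M L) (St M Bool)} {ret : I → L} {i : I}
    {φ : (M i).Γ (M i).k₀ ≃ Bool} {ψ : (M i).Γ (M i).k₁ ≃ Bool} {t : ℕ} {x y : Str}
    (h : Reach (M i).m t
      ⟨some (M i).main, (M i).initialState, single (M i).k₀ (x.map φ.symm)⟩
      ⟨none, (M i).initialState, single (M i).k₁ (y.map ψ.symm)⟩) {u : Fin 3} {l l' : L}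
    (hl : m l = load u i φ.symm l) (hr : m (ret i) = unload u i ψ (ret i) l')
    (s : Fin 3 → List Bool) (hs : s u = x.reverse) :
    Reach (prog m ret) (x.length + t + y.length + 2) (cfg (some (.inl l)) s empty)
      (cfg (some (.inl l')) (update s u y.reverse) empty) := by
  have h1 := reach_load (ret := ret) hl s
  have h2 := reach_run (m := m) (ret := ret) i (update s u []) h
  have h3 := reach_unload (ret := ret) hr (update s u []) (by simp) (y.map ψ.symm)
  simp only [hs, List.reverse_reverse, List.length_reverse] at h1
  simp only [← List.map_reverse, List.map_map, Equiv.self_comp_symm, List.map_id,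
    List.length_map, update_idem] at h3
  exact ((h1.trans h2).trans h3).mono (by omega)

/-- The input is copied to two stacks, one for each call. The code of the pair is then written from
its end: `g s`, the separator, the doubled letters of `f s`. -/
theorem polyTime_pair {f g : Str → Str} (hf : PolyTime id id f) (hg : PolyTime id id g) :
    PolyTime id id fun s => enc (f s, g s) := by
  obtain ⟨r, hr⟩ := hf.length_le
  obtain ⟨r', hr'⟩ := hg.length_le
  obtain ⟨N, i₁, o₁, p, hf⟩ := polyTime_iff.1 hf
  obtain ⟨N', i₂, o₂, q, hg⟩ := polyTime_iff.1 hg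
  let M : Bool → FinTM2 := fun b => cond b N' N
  let m : PairLabel → TM2.Stmt (Γ M Bool) (Lab M PairLabel) (St M Bool)
    | .copy => drain (.inl 0) (fun a => a)
        (fun q => .push (.inl 1) (fun v => v.1.getD default)
          (.push (.inl 2) (fun v => v.1.getD default) q)) .copy (.goto fun _ => .inl (.load false))
    | .load false => load (M := M) 1 false i₁.symm (.load false)
    | .load true => load (M := M) 2 true i₂.symm (.load true)
    | .unload false => unload (M := M) 1 false o₁ (.unload false) (.load true)
    | .unload true => unload (M := M) 2 true o₂ (.unload true) .emit
    | .emit => drain (.inl 2) (fun a => a) (.push (.inl 0) (fun v => v.1.getD default)) .emit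
        (.push (.inl 0) (fun _ => false) (.goto fun _ => .inl .emitDbl))
    | .emitDbl => drain (.inl 1) (fun a => a)
        (fun q => .push (.inl 0) (fun v => v.1.getD default) (.push (.inl 0) (fun _ => true) q))
        .emitDbl .halt
  let ret : Bool → PairLabel := PairLabel.unload
  refine PolyTime.intro (machine (M := M) m ret (.inl .copy) (.inl 0) (.inl 0)) (.refl _) (.refl _)
    (T := fun n => n + 1 + (n + p.eval n + r.eval n + 2) + (n + q.eval n + r'.eval n + 2) +
      (r'.eval n + 1) + (r.eval n + 1)) ?_ fun a => ?_
  · exact ((((PolyBdd.id.add (.const _)).add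
      (((PolyBdd.id.add (.eval _)).add (.eval _)).add (.const _))).add
      (((PolyBdd.id.add (.eval _)).add (.eval _)).add (.const _))).add
      ((PolyBdd.eval _).add (.const _))).add ((PolyBdd.eval _).add (.const _))
  have h1 := Reach.loop (m := prog m ret) (fun d l => cfg (some (.inl .copy)) ![l, d, d] empty)
    (fun d a l => by simp [prog, m, drain]) [] a
  have h1' : Reach (prog m ret) 1 (cfg (some (.inl .copy)) ![[], a.reverse, a.reverse] empty)
      (cfg (some (.inl (.load false))) ![[], a.reverse, a.reverse] empty) :=
    .single (by simp [prog, m, drain])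
  have h2 := reach_call (M := M) (m := m) (ret := ret) (i := false) (u := 1) (l := .load false)
    (l' := .load true) (φ := i₁) (ψ := o₁) (hf a) rfl rfl ![[], a.reverse, a.reverse] rfl
  have h3 := reach_call (M := M) (m := m) (ret := ret) (i := true) (u := 2) (l := .load true)
    (l' := .emit) (φ := i₂) (ψ := o₂) (hg a) rfl rfl ![[], (f a).reverse, a.reverse] rfl
  have h4 := Reach.loop (m := prog m ret)
    (fun d l => cfg (some (.inl .emit)) ![d, (f a).reverse, l] empty)
    (fun d a l => by simp [prog, m, drain]) [] (g a).reverse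
  have h4' : Reach (prog m ret) 1 (cfg (some (.inl .emit)) ![g a, (f a).reverse, []] empty)
      (cfg (some (.inl .emitDbl)) ![false :: g a, (f a).reverse, []] empty) :=
    .single (by simp [prog, m, drain])
  have h5 := Reach.loop (m := prog m ret)
    (fun d l => cfg (some (.inl .emitDbl)) ![dbl d ++ false :: g a, l, []] empty)
    (fun d a l => by simp [prog, m, drain]) [] (f a).reverse
  have h5' : Reach (prog m ret) 1 (cfg (some (.inl .emitDbl)) ![enc (f a, g a), [], []] empty)
      (cfg none ![enc (f a, g a), [], []] empty) :=
    .single (by simp [prog, m, drain])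
  simp only [update_one, update_two, List.reverse_reverse, List.append_nil, dbl_nil,
    List.nil_append, List.length_reverse] at h1 h2 h3 h4 h5
  have h := (((((((h1.trans h1').trans h2).trans h3).trans h4).trans h4').trans h5).trans h5')
  simp only [cfg, store_empty] at h
  have := hr a
  have := hr' a
  simp only [id] at *
  show Reach (prog m ret) _ ⟨_, _, single (K := K M) (Γ := Γ M Bool) (.inl 0) (List.map id _)⟩
    ⟨_, _, single (K := K M) (Γ := Γ M Bool) (.inl 0) (List.map id _)⟩
  rw [List.map_id, List.map_id]
  exact h.mono (by omega)

/-- Labels of the machine for iterations. -/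
inductive IterLabel
  | copy | check | load | unload | emit
  deriving DecidableEq

instance : Fintype IterLabel :=
  ⟨{.copy, .check, .load, .unload, .emit}, by rintro ⟨⟩ <;> simp⟩

/-- A copy of the input serves as the counter of rounds. The hypothesis `hr` is essential, since
iterating a polynomial-time function can produce exponentially long words. -/
theorem polyTime_iterate {α : Type} {ea : α → Str} {f : Str → Str} (hf : PolyTime id id f)
    (r : Polynomial ℕ)
    (hr : ∀ a, ∀ n ≤ (ea a).length, (f^[n] (ea a)).length ≤ r.eval (ea a).length) :
    PolyTime ea id fun a => f^[(ea a).length] (ea a) := by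
  obtain ⟨N, i₁, o₁, p, hf⟩ := polyTime_iff.1 hf
  let M : Unit → FinTM2 := fun _ => N
  let m : IterLabel → TM2.Stmt (Γ M Bool) (Lab M IterLabel) (St M Bool)
    | .copy => drain (.inl 0) (fun a => a)
        (fun q => .push (.inl 1) (fun v => v.1.getD default)
          (.push (.inl 2) (fun v => v.1.getD default) q)) .copy (.goto fun _ => .inl .check)
    | .check => .pop (.inl 1) (fun v a => (a, v.2)) <| .branch (fun v => v.1.isSome)
        (.load (fun v => (none, v.2)) <| .goto fun _ => .inl .load) (.goto fun _ => .inl .emit)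
    | .load => load (M := M) 2 () i₁.symm .load
    | .unload => unload (M := M) 2 () o₁ .unload .check
    | .emit => drain (.inl 2) (fun a => a) (.push (.inl 0) (fun v => v.1.getD default)) .emit .halt
  let ret : Unit → IterLabel := fun _ => .unload
  -- The cost of one round: load, run and unload words of length at most `r.eval n`, and pop one
  -- letter of the counter.
  let T : ℕ → ℕ := fun n => r.eval n + p.eval (r.eval n) + r.eval n + 3
  refine PolyTime.intro (machine (M := M) m ret (.inl .copy) (.inl 0) (.inl 0)) (.refl _) (.refl _)
    (T := fun n => n + 1 + n * T n + 1 + r.eval n + 1) ?_ fun a => ?_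
  · exact ((((PolyBdd.id.add (.const _)).add (PolyBdd.id.mul
      ((((PolyBdd.eval _).add ((PolyBdd.eval _).comp _)).add (.eval _)).add (.const _)))).add
        (.const _)).add (.eval _)).add (.const _)
  have hr := hr a
  generalize ea a = a at hr
  have h1 := Reach.loop (m := prog m ret) (fun d l => cfg (some (.inl .copy)) ![l, d, d] empty)
    (fun d a l => by simp [prog, m, drain]) [] a
  have h1' : Reach (prog m ret) 1 (cfg (some (.inl .copy)) ![[], a.reverse, a.reverse] empty)
      (cfg (some (.inl .check)) ![[], a.reverse, a.reverse] empty) :=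
    .single (by simp [prog, m, drain])
  -- Loop invariant: the second stack holds the remaining rounds, the third the reversed `n`-th
  -- iterate.
  have h2 : ∀ (l : Str) (n : ℕ), n + l.length = a.length → Reach (prog m ret)
      (l.length * T a.length) (cfg (some (.inl .check)) ![[], l, (f^[n] a).reverse] empty)
      (cfg (some (.inl .check)) ![[], [], (f^[a.length] a).reverse] empty) := by
    intro l
    induction l with
    | nil =>
      intro n hn
      obtain rfl : n = a.length := by simpa using hn
      exact .refl _ _
    | cons b l ih =>
      intro n hn
      rw [List.length_cons] at hn
      have e1 : Reach (prog m ret) 1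
          (cfg (some (.inl .check)) ![[], b :: l, (f^[n] a).reverse] empty)
          (cfg (some (.inl .load)) ![[], l, (f^[n] a).reverse] empty) :=
        .single (by simp [prog, m])
      have e2 := reach_call (M := M) (m := m) (ret := ret) (i := ()) (u := 2) (l := .load)
        (l' := .check) (φ := i₁) (ψ := o₁) (hf (f^[n] a)) rfl rfl ![[], l, (f^[n] a).reverse] rfl
      simp only [update_two, ← iterate_succ_apply' f, Nat.succ_eq_add_one] at e2
      refine ((e1.trans e2).trans (ih (n + 1) (by omega))).mono ?_
      have h3 := hr n (by omega)
      have h4 := hr (n + 1) (by omega)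
      have h5 := eval_mono p h3
      simp only [id, List.length_cons, T, add_mul, one_mul] at h5 ⊢
      omega
  have h3 := Reach.loop (m := prog m ret) (fun d l => cfg (some (.inl .emit)) ![d, [], l] empty)
    (fun d a l => by simp [prog, m, drain]) [] (f^[a.length] a).reverse
  have h2' : Reach (prog m ret) 1
      (cfg (some (.inl .check)) ![[], [], (f^[a.length] a).reverse] empty)
      (cfg (some (.inl .emit)) ![[], [], (f^[a.length] a).reverse] empty) :=
    .single (by simp [prog, m])
  have h3' : Reach (prog m ret) 1 (cfg (some (.inl .emit)) ![f^[a.length] a, [], []] empty)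
      (cfg none ![f^[a.length] a, [], []] empty) :=
    .single (by simp [prog, m, drain])
  simp only [List.reverse_reverse, List.append_nil, List.length_reverse] at h1 h3
  have h := (((((h1.trans h1').trans (h2 a.reverse 0 (by simp))).trans h2').trans h3).trans h3')
  simp only [cfg, store_empty] at h
  show Reach (prog m ret) _ ⟨_, _, single (K := K M) (Γ := Γ M Bool) (.inl 0) (List.map id _)⟩
    ⟨_, _, single (K := K M) (Γ := Γ M Bool) (.inl 0) (List.map id _)⟩
  rw [List.map_id, List.map_id]
  refine h.mono ?_
  have := hr _ le_rfl
  simp only [List.length_reverse]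
  omega

/-! ### Finite-state transducers -/

namespace FST

variable {Q A B : Type}

/-- The output of the transducer with transitions `δ` and final outputs `fin`. -/
def run (δ : Q → A → Q × List B) (fin : Q → List B) : Q → List A → List B
  | q, [] => fin q
  | q, a :: l => (δ q a).2 ++ run δ fin (δ q a).1 l

variable (A B) in
/-- An input stack, an auxiliary stack, an output stack. -/
abbrev Γ : Fin 3 → Type
  | 0 => A
  | 1 => B
  | 2 => B

/-- The three stacks. -/
def store (x : List A) (y z : List B) : ∀ k, List (Γ A B k)
  | 0 => x
  | 1 => y
  | 2 => z

@[simp] theorem store_zero (x : List A) (y z : List B) : store x y z 0 = x := rfl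
@[simp] theorem store_one (x : List A) (y z : List B) : store x y z 1 = y := rfl
@[simp] theorem store_two (x : List A) (y z : List B) : store x y z 2 = z := rfl

@[simp] theorem update_zero (x x' : List A) (y z : List B) :
    update (store x y z) 0 x' = store x' y z := by
  funext u; fin_cases u <;> rfl

@[simp] theorem update_one (x : List A) (y y' z : List B) :
    update (store x y z) 1 y' = store x y' z := by
  funext u; fin_cases u <;> rfl

@[simp] theorem update_two (x : List A) (y z z' : List B) :
    update (store x y z) 2 z' = store x y z' := by
  funext u; fin_cases u <;> rfl

/-- State, letter that was read, letter that is moved. -/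
abbrev St (Q A B : Type) : Type := Q × Option A × Option B

variable [Inhabited B]

/-- Push the at most `n` letters `out v`. -/
def pushAll : ℕ → (St Q A B → List B) → TM2.Stmt (Γ A B) Bool (St Q A B) →
    TM2.Stmt (Γ A B) Bool (St Q A B)
  | 0, _, q => q
  | n + 1, out, q => .branch (fun v => (out v).isEmpty) q
      (.push 1 (fun v => (out v).headD default) (pushAll n (fun v => (out v).tail) q))

theorem stepAux_pushAll (n : ℕ) (out : St Q A B → List B) (q : TM2.Stmt (Γ A B) Bool (St Q A B))
    (v : St Q A B) (x : List A) (y z : List B) (h : (out v).length ≤ n) :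
    TM2.stepAux (pushAll n out q) v (store x y z) =
      TM2.stepAux q v (store x ((out v).reverse ++ y) z) := by
  induction n generalizing out y with
  | zero => simp [pushAll, List.length_eq_zero_iff.1 (Nat.le_zero.1 h)]
  | succ n ih =>
    cases e : out v with
    | nil => simp [pushAll, e]
    | cons b l => simp [pushAll, e, ih (fun v => (out v).tail) _ (by simp [e] at h ⊢; omega)]

/-- The program of a transducer. -/
def prog (δ : Q → A → Q × List B) (fin : Q → List B) (q₀ : Q) (n : ℕ) :
    Bool → TM2.Stmt (Γ A B) Bool (St Q A B)
  | false => .pop 0 (fun v a => (v.1, a, none)) <| .branch (fun v => v.2.1.isSome)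
      (pushAll n (fun v => v.2.1.elim [] fun a => (δ v.1 a).2) <|
        .load (fun v => (v.2.1.elim q₀ fun a => (δ v.1 a).1, none, none)) <| .goto fun _ => false)
      (pushAll n (fun v => fin v.1) <| .load (fun _ => (q₀, none, none)) <| .goto fun _ => true)
  | true => .pop 1 (fun v b => (v.1, none, b)) <| .branch (fun v => v.2.2.isSome)
      (.push 2 (fun v => v.2.2.getD default) <| .load (fun _ => (q₀, none, none)) <|
        .goto fun _ => true) .halt

/-- The output collects in reverse on the auxiliary stack; a later transfer to the output stack
restores its order. The state returns to `q₀` because a halted machine must be in its initial state.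
-/
theorem reach_read {δ : Q → A → Q × List B} {fin : Q → List B} {q₀ : Q} {n : ℕ}
    (hδ : ∀ q a, (δ q a).2.length ≤ n) (hfin : ∀ q, (fin q).length ≤ n) (q : Q) (x : List A)
    (y : List B) :
    Reach (prog δ fin q₀ n) (x.length + 1) ⟨some false, (q, none, none), store x y []⟩
      ⟨some true, (q₀, none, none), store [] ((run δ fin q x).reverse ++ y) []⟩ := by
  induction x generalizing q y with
  | nil =>
    refine .single ?_
    simp [prog, stepAux_pushAll, hfin, run]
  | cons a x ih =>
    refine Reach.head ?_ (e := _) (by simpa [run] using ih (δ q a).1 ((δ q a).2.reverse ++ y))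
    simp only [prog, TM2.step, TM2.stepAux, store_zero, List.head?_cons, List.tail_cons,
      update_zero, Option.isSome_some, cond_true]
    rw [stepAux_pushAll _ _ _ _ _ _ _ (hδ q a)]
    rfl

/-- The bundled machine. -/
def machine [Fintype Q] [Fintype A] [Fintype B] (δ : Q → A → Q × List B) (fin : Q → List B)
    (q₀ : Q) (n : ℕ) : FinTM2 where
  K := Fin 3
  k₀ := 0
  k₁ := 2
  Γ := Γ A B
  Λ := Bool
  main := false
  σ := St Q A B
  initialState := (q₀, none, none)
  Γk₀Fin := inferInstanceAs (Fintype A)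
  m := prog δ fin q₀ n

theorem polyTime [Fintype Q] [Fintype A] [Fintype B] (δ : Q → A → Q × List B) (fin : Q → List B)
    (q₀ : Q) : PolyTime id id (run δ fin q₀) := by
  obtain ⟨n, hδ, hfin⟩ : ∃ n, (∀ q a, (δ q a).2.length ≤ n) ∧ ∀ q, (fin q).length ≤ n := by
    -- There are finitely many transitions; sums serve as crude maxima.
    refine ⟨∑ p : Q × A, (δ p.1 p.2).2.length + ∑ q, (fin q).length, fun q a => ?_, fun q => ?_⟩
    · have := Finset.single_le_sum (f := fun p : Q × A => (δ p.1 p.2).2.length) (by simp)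
        (Finset.mem_univ (q, a))
      simp only at this
      omega
    · have := Finset.single_le_sum (f := fun q => (fin q).length) (by simp) (Finset.mem_univ q)
      omega
  refine PolyTime.intro (machine δ fin q₀ n) (.refl A) (.refl B)
    (T := fun k => (k + 1) + ((k + 1) * n + 1)) ?_ fun x => ?_
  · exact (PolyBdd.id.add (.const _)).add (((PolyBdd.id.add (.const _)).mul (.const _)).add
      (.const _))
  have hlen : ∀ q, (run δ fin q x).length ≤ (x.length + 1) * n := by
    clear * - hδ hfin
    induction x with
    | nil => intro q; simpa [run] using hfin q
    | cons a x ih =>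
      intro q
      have h1 := hδ q a
      have h2 := ih (δ q a).1
      simp only [run, List.length_append, List.length_cons, add_mul, one_mul] at h2 ⊢
      omega
  have h1 := reach_read (q₀ := q₀) hδ hfin q₀ x []
  have h2 := Reach.loop (m := prog δ fin q₀ n)
    (fun d l => ⟨some true, (q₀, none, none), store [] l d⟩) (fun d a l => by simp [prog]) []
    (run δ fin q₀ x).reverse
  have h3 : Reach (prog δ fin q₀ n) 1
      ⟨some true, (q₀, none, none), store [] [] (run δ fin q₀ x)⟩
      ⟨none, (q₀, none, none), store [] [] (run δ fin q₀ x)⟩ := .single (by simp [prog])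
  simp only [List.reverse_reverse, List.append_nil, List.length_reverse] at h1 h2
  have e0 : store x ([] : List B) [] = single 0 x := by
    funext u; fin_cases u <;> rfl
  have e1 : store ([] : List A) [] (run δ fin q₀ x) = single 2 (run δ fin q₀ x) := by
    funext u; fin_cases u <;> rfl
  have h := h1.trans (h2.trans h3)
  rw [e0, e1] at h
  show Reach (prog δ fin q₀ n) _ ⟨_, _, single (K := Fin 3) (Γ := Γ A B) 0 (List.map id _)⟩
    ⟨_, _, single (K := Fin 3) (Γ := Γ A B) 2 (List.map id _)⟩
  rw [List.map_id, List.map_id]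
  refine h.mono ?_
  have := hlen q₀
  simp only [id]
  omega

end FST

/-! ### Polynomial-time functions on strings -/

/-- Inverse of `enc`. -/
def dec : Str → Str × Str
  | [] => ([], [])
  | false :: s => ([], s)
  | [true] => ([], [])
  | true :: b :: s => (b :: (dec s).1, (dec s).2)

@[simp] theorem dec_enc (q : Str × Str) : dec (enc q) = q := by
  obtain ⟨x, y⟩ := q
  induction x with
  | nil => simp [enc, dec]
  | cons b x ih =>
    simp only [enc] at ih
    simp [enc, dec, ih]

theorem length_dec (s : Str) : 2 * (dec s).1.length + (dec s).2.length ≤ s.length := by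
  induction s using dec.induct with
  | case1 => simp [dec]
  | case2 s => simp [dec]
  | case3 => simp [dec]
  | case4 b s ih => simp only [dec, List.length_cons]; omega

theorem polyTime_enc : PolyTime pairCode id enc := by
  refine (FST.polyTime (Q := Bool) (A := Option Bool) (B := Bool)
    (fun q a => q.casesOn (a.elim (true, [false]) fun b => (false, [true, b]))
      (a.elim (true, []) fun b => (true, [b]))) (fun _ => []) false).recode fun q => ?_
  obtain ⟨x, y⟩ := q
  induction x with
  | nil =>
    suffices h : ∀ y : Str, FST.run _ _ true (y.map some) = y by
      simpa [enc, pairCode, FST.run] using (h y).symm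
    intro y
    induction y with
    | nil => rfl
    | cons b y ih => simpa [FST.run] using ih
  | cons b x ih => simpa [pairCode, FST.run, enc] using ih

theorem polyTime_dec : PolyTime id pairCode dec := by
  refine (FST.polyTime (Q := Fin 3) (A := Bool) (B := Option Bool)
    -- State `0` awaits a marker, `1` a letter of the first component, and `2` copies the second. If
    -- a malformed code ends before its separator, the final output supplies one.
    (fun q a => match q with
      | 0 => if a then (1, []) else (2, [none])
      | 1 => (0, [some a])
      | 2 => (2, [some a])) (fun q => if q = 2 then [] else [none]) 0).recode fun s => ?_
  generalize hδ : (fun (q : Fin 3) (a : Bool) => _) = δ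
  generalize hfin : (fun (q : Fin 3) => _) = fin
  have h0 : δ 0 true = (1, []) := by rw [← hδ]; rfl
  have h0' : δ 0 false = (2, [none]) := by rw [← hδ]; rfl
  have h1 (b : Bool) : δ 1 b = (0, [some b]) := by rw [← hδ]
  have h2 (b : Bool) : δ 2 b = (2, [some b]) := by rw [← hδ]
  have h : ∀ y : Str, FST.run δ fin 2 y = y.map some := by
    intro y
    induction y with
    | nil => simp [FST.run, ← hfin]
    | cons b y ih => simp [FST.run, ih, h2]
  induction s using dec.induct with
  | case1 => simp [FST.run, ← hfin, dec, pairCode]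
  | case2 s => simp [FST.run, dec, pairCode, h, h0']
  | case3 => simp [FST.run, ← hfin, h0, dec, pairCode]
  | case4 b s ih => simpa [pairCode, FST.run, dec, h0, h1] using ih

theorem polyTime_fst : PolyTime pairCode id (Prod.fst : Str × Str → Str) := by
  refine (FST.polyTime (Q := Bool) (A := Option Bool) (B := Bool)
    (fun q a => q.casesOn (a.elim (true, []) fun b => (false, [b])) (true, []))
    (fun _ => []) false).recode fun q => ?_
  obtain ⟨x, y⟩ := q
  induction x with
  | nil =>
    suffices h : ∀ y : Str, FST.run _ _ true (y.map some) = [] by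
      simpa [pairCode, FST.run] using (h y).symm
    intro y
    induction y with
    | nil => rfl
    | cons b y ih => simpa [FST.run] using ih
  | cons b x ih => simpa [pairCode, FST.run] using ih

theorem polyTime_snd : PolyTime pairCode id (Prod.snd : Str × Str → Str) := by
  refine (FST.polyTime (Q := Bool) (A := Option Bool) (B := Bool)
    (fun q a => q.casesOn (a.elim (true, []) fun b => (false, []))
      (a.elim (true, []) fun b => (true, [b]))) (fun _ => []) false).recode fun q => ?_
  obtain ⟨x, y⟩ := q
  induction x with
  | nil =>
    suffices h : ∀ y : Str, FST.run _ _ true (y.map some) = y by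
      simpa [pairCode, FST.run] using (h y).symm
    intro y
    induction y with
    | nil => rfl
    | cons b y ih => simpa [FST.run] using ih
  | cons b x ih => simpa [pairCode, FST.run] using ih

theorem polyTime_append : PolyTime pairCode id fun q : Str × Str => q.1 ++ q.2 := by
  refine (FST.polyTime (Q := Unit) (A := Option Bool) (B := Bool)
    (fun _ a => ((), a.toList)) (fun _ => []) ()).recode fun q => ?_
  obtain ⟨x, y⟩ := q
  induction x with
  | nil =>
    suffices h : ∀ y : Str, FST.run _ _ () (y.map some) = y by
      simpa [pairCode, FST.run] using (h y).symm
    intro y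
    induction y with
    | nil => rfl
    | cons b y ih => simpa [FST.run] using ih
  | cons b x ih => simpa [pairCode, FST.run] using ih

/-- The source of all branching. The state records whether the first component begins with `true`
and whether the separator has been passed. -/
theorem polyTime_guard :
    PolyTime pairCode id fun q : Str × Str => if q.1.head? = some true then q.2 else [] := by
  refine (FST.polyTime (Q := Option (Bool × Bool)) (A := Option Bool) (B := Bool)
    (fun q a => match q, a with
      | none, none => (some (false, true), [])
      | none, some b => (some (b, false), [])
      | some (c, false), none => (some (c, true), [])
      | some (c, false), some _ => (some (c, false), [])
      | some (c, true), none => (some (c, true), [])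
      | some (c, true), some b => (some (c, true), if c then [b] else []))
    (fun _ => []) none).recode fun q => ?_
  obtain ⟨x, y⟩ := q
  generalize hδ : (fun (q : Option (Bool × Bool)) (a : Option Bool) => _) = δ
  have h : ∀ (c : Bool) (y : Str), FST.run δ (fun _ => []) (some (c, true)) (y.map some) =
      if c then y else [] := by
    intro c y
    induction y with
    | nil => simp [FST.run]
    | cons b y ih =>
      rw [List.map_cons, FST.run]
      have : δ (some (c, true)) (some b) = (some (c, true), if c then [b] else []) := by
        rw [← hδ]
      rw [this, ih]
      cases c <;> rfl
  have h' : ∀ (c : Bool) (x y : Str), FST.run δ (fun _ => []) (some (c, false))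
      (pairCode (x, y)) = if c then y else [] := by
    intro c x y
    induction x with
    | nil =>
      have : δ (some (c, false)) none = (some (c, true), []) := by rw [← hδ]
      simp [pairCode, FST.run, this, h]
    | cons b x ih =>
      have : δ (some (c, false)) (some b) = (some (c, false), []) := by rw [← hδ]
      simpa [pairCode, FST.run, this] using ih
  cases x with
  | nil =>
    have : δ none none = (some (false, true), []) := by rw [← hδ]
    simp [pairCode, FST.run, this, h]
  | cons b x =>
    have : δ none (some b) = (some (b, false), []) := by rw [← hδ]
    have := h' b x y
    simp only [pairCode] at this
    cases b <;> simp_all [pairCode, FST.run]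

/-- Polynomial-time computable functions on strings. -/
def FP (f : Str → Str) : Prop := PolyTime id id f

/-- Polynomial-time decidable properties of strings. -/
def FB (c : Str → Bool) : Prop := FP fun s => [c s]

theorem FP.comp {f g : Str → Str} (hf : FP f) (hg : FP g) : FP fun s => f (g s) :=
  PolyTime.comp (eb := id) hf hg

theorem FP.pair {f g : Str → Str} (hf : FP f) (hg : FP g) : FP fun s => enc (f s, g s) :=
  polyTime_pair hf hg

theorem PolyTime.comp_pair {β B : Type} {eb : β → List B} {F : Str × Str → β}
    (hF : PolyTime pairCode eb F) {f g : Str → Str} (hf : FP f) (hg : FP g) :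
    PolyTime id eb fun s => F (f s, g s) := by
  simpa only [dec_enc] using hF.comp (polyTime_dec.comp (eb := id) (hf.pair hg))

/-- Two-argument functions from functions on codes. -/
theorem PolyTime.of_dec {β B : Type} {eb : β → List B} {F : Str × Str → β}
    (hF : PolyTime id eb fun s => F (dec s)) : PolyTime pairCode eb F := by
  simpa only [dec_enc] using PolyTime.comp (eb := id) hF polyTime_enc

theorem FP.id : FP fun s => s := by
  refine (FST.polyTime (Q := Unit) (A := Bool) (B := Bool)
    (fun _ a => ((), [a])) (fun _ => []) ()).recode fun s => ?_
  induction s with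
  | nil => rfl
  | cons b s ih => simpa [FST.run] using ih

theorem FP.const (w : Str) : FP fun _ => w := by
  refine (FST.polyTime (Q := Unit) (A := Bool) (B := Bool)
    (fun _ _ => ((), [])) (fun _ => w) ()).recode fun s => ?_
  induction s with
  | nil => rfl
  | cons b s ih => simpa [FST.run] using ih

theorem FP.fst : FP fun s => (dec s).1 := polyTime_fst.comp polyTime_dec

theorem FP.snd : FP fun s => (dec s).2 := polyTime_snd.comp polyTime_dec

theorem FP.append {f g : Str → Str} (hf : FP f) (hg : FP g) : FP fun s => f s ++ g s :=
  polyTime_append.comp_pair hf hg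

theorem FP.cons (b : Bool) {f : Str → Str} (hf : FP f) : FP fun s => b :: f s :=
  (FP.const [b]).append hf

theorem FP.tail {f : Str → Str} (hf : FP f) : FP fun s => (f s).tail := by
  refine FP.comp (f := List.tail) ?_ hf
  refine (FST.polyTime (Q := Bool) (A := Bool) (B := Bool)
    (fun q a => (true, if q then [a] else [])) (fun _ => []) false).recode fun s => ?_
  cases s with
  | nil => rfl
  | cons b s =>
    suffices h : ∀ s, FST.run _ _ true s = s by simpa [FST.run] using (h s).symm
    intro s
    induction s with
    | nil => rfl
    | cons b s ih => simpa [FST.run] using ih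

theorem FB.head (t : Option Bool → Bool) {f : Str → Str} (hf : FP f) : FB fun s => t (f s).head? := by
  refine FP.comp (f := fun s => [t s.head?]) ?_ hf
  refine (FST.polyTime (Q := Option Bool) (A := Bool) (B := Bool)
    (fun q a => (some (q.getD a), [])) (fun q => [t q]) none).recode fun s => ?_
  cases s with
  | nil => rfl
  | cons b s =>
    suffices h : ∀ s, FST.run _ _ (some b) s = [t (some b)] by simpa [FST.run] using (h s).symm
    intro s
    induction s with
    | nil => rfl
    | cons b s ih => simpa [FST.run] using ih

theorem FB.not {c : Str → Bool} (hc : FB c) : FB fun s => !c s :=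
  FB.head (fun o => !(o == some true)) hc |> fun h => by simpa [FB] using h

/-- The branches are guarded by opposite conditions, so at least one guarded word is empty and
concatenation selects the right one. -/
theorem FP.ite {c : Str → Bool} (hc : FB c) {f g : Str → Str} (hf : FP f) (hg : FP g) :
    FP fun s => if c s then f s else g s := by
  have h := FP.append (polyTime_guard.comp_pair hc hf) (polyTime_guard.comp_pair hc.not hg)
  have e : (fun s => if c s then f s else g s) = fun s =>
      (if [c s].head? = some true then f s else []) ++
        if [!c s].head? = some true then g s else [] := by
    funext s
    cases c s <;> simp
  rw [e]
  exact h

theorem FB.and {c d : Str → Bool} (hc : FB c) (hd : FB d) : FB fun s => c s && d s := by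
  have h := FP.ite hc hd (.const [false])
  have e : (fun s => [c s && d s]) = fun s => if c s then [d s] else [false] := by
    funext s
    cases c s <;> rfl
  rw [FB, e]
  exact h

theorem FB.or {c d : Str → Bool} (hc : FB c) (hd : FB d) : FB fun s => c s || d s := by
  simpa using (hc.not.and hd.not).not

theorem FB.isEmpty {f : Str → Str} (hf : FP f) : FB fun s => (f s).isEmpty := by
  have e : (fun s => (f s).isEmpty) = fun s => (f s).head?.isNone := by
    funext s
    cases f s <;> rfl
  rw [e]
  exact FB.head Option.isNone hf

/-- Counter and value are packed into one word. A step consumes one letter of the counter and is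
idle once none is left, so iterating as often as the packed word is long applies `f` exactly `(c
s).length` times. -/
theorem FP.repeat {c h f : Str → Str} (hc : FP c) (hh : FP h) (hf : FP f) (r : Polynomial ℕ)
    (hr : ∀ s, ∀ n ≤ (c s).length,
      (f^[n] (h s)).length ≤ r.eval ((c s).length + (h s).length)) :
    FP fun s => f^[(c s).length] (h s) := by
  let step : Str → Str := fun u =>
    if (dec u).1.isEmpty then u else enc ((dec u).1.tail, f (dec u).2)
  have hstep : FP step := .ite (.isEmpty .fst) .id (.pair (.tail .fst) (hf.comp .snd))
  have key : ∀ (n : ℕ) (k x : Str),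
      step^[n] (enc (k, x)) = enc (k.drop n, f^[min n k.length] x) := by
    intro n
    induction n with
    | zero => simp
    | succ n ih =>
      intro k x
      rw [iterate_succ_apply]
      cases k with
      | nil =>
        have : step (enc ([], x)) = enc ([], x) := by simp [step]
        rw [this, ih]
        simp
      | cons b k =>
        have : step (enc (b :: k, x)) = enc (k, f x) := by simp [step]
        rw [this, ih, ← iterate_succ_apply]
        simp
  let u : Str → Str := fun s => enc (c s, h s)
  -- The map `u` is treated as an encoding, so that `polyTime_iterate` starts from the word `u s`.
  have hu : PolyTime _root_.id u (fun s : Str => s) :=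
    PolyTime.recode (F := u) (hc.pair hh) fun s => rfl
  have h1 := polyTime_iterate (ea := u) hstep (.X + r) fun s n _ => by
    have h1 := hr s (min n (c s).length) (by omega)
    have h2 : (c s).length + (h s).length ≤ (u s).length := by simp [u]; omega
    have h3 := h1.trans (eval_mono r h2)
    simp only [u, key, length_enc, List.length_drop, Polynomial.eval_add, Polynomial.eval_X] at h3 ⊢
    omega
  have h2 : FP fun s => step^[(u s).length] (u s) := h1.comp hu
  have h3 := FP.snd.comp h2
  convert h3 using 2 with s
  simp only [u, key, dec_enc, length_enc]
  congr 2
  omega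

theorem FP.drop {c h : Str → Str} (hc : FP c) (hh : FP h) :
    FP fun s => (h s).drop (c s).length := by
  have e : ∀ (n : ℕ) (l : Str), List.tail^[n] l = l.drop n := by
    intro n
    induction n with
    | zero => simp
    | succ n ih => intro l; rw [iterate_succ_apply, ih]; cases l <;> simp
  simp only [← e]
  refine FP.repeat hc hh (FP.tail .id) .X fun s n _ => ?_
  simp only [e, List.length_drop, Polynomial.eval_X]
  omega

/-- Remove the first letters of two strings if they agree. -/
def strip (u : Str) : Str :=
  if ((dec u).1.head? == some true && (dec u).2.head? == some true) ||
      ((dec u).1.head? == some false && (dec u).2.head? == some false) then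
    enc ((dec u).1.tail, (dec u).2.tail) else u

theorem FP.strip : FP strip :=
  .ite (.or (.and (.head (· == some true) .fst) (.head (· == some true) .snd))
    (.and (.head (· == some false) .fst) (.head (· == some false) .snd)))
    (.pair (.tail .fst) (.tail .snd)) .id

theorem length_strip (u : Str) : (AOWF.strip u).length ≤ u.length := by
  have := length_dec u
  unfold AOWF.strip
  split_ifs with h
  · cases h1 : (dec u).1 <;> cases h2 : (dec u).2 <;> simp_all
    omega
  · exact le_rfl

/-- Two words are equal iff stripping common first letters exhausts both; a pair whose first letters
disagree is a fixed point. This makes equality decidable in polynomial time. -/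
theorem iterate_strip (x y : Str) : ∃ x' y', AOWF.strip^[x.length] (enc (x, y)) = enc (x', y') ∧
    (x' = [] ∧ y' = [] ↔ x = y) := by
  induction x generalizing y with
  | nil => exact ⟨[], y, rfl, by simp [eq_comm]⟩
  | cons a x ih =>
    by_cases h : y.head? = some a
    · obtain ⟨y, rfl⟩ : ∃ y', y = a :: y' := by
        cases y with
        | nil => simp at h
        | cons b y => exact ⟨y, by simpa using h⟩
      obtain ⟨x', y', h1, h2⟩ := ih y
      refine ⟨x', y', ?_, by simpa using h2⟩
      rw [List.length_cons, iterate_succ_apply, ← h1]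
      congr 1
      cases a <;> simp [AOWF.strip]
    · refine ⟨a :: x, y, iterate_fixed ?_ _, ?_⟩
      · cases a <;> simp [AOWF.strip, h]
      · simp only [reduceCtorEq, false_and, false_iff]
        rintro rfl
        simp at h

theorem FB.eq {f g : Str → Str} (hf : FP f) (hg : FP g) : FB fun s => decide (f s = g s) := by
  have h1 := FP.repeat hf (hf.pair hg) FP.strip .X fun s n _ => by
    have : ∀ n u, (AOWF.strip^[n] u).length ≤ u.length := by
      intro n
      induction n with
      | zero => simp
      | succ n ih => intro u; exact (ih _).trans (length_strip u)
    have := this n (enc (f s, g s))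
    simp only [Polynomial.eval_X]
    omega
  have h2 := FB.and (.isEmpty (FP.fst.comp h1)) (.isEmpty (FP.snd.comp h1))
  have e : (fun s => decide (f s = g s)) = fun s =>
      (dec (AOWF.strip^[(f s).length] (enc (f s, g s)))).1.isEmpty &&
      (dec (AOWF.strip^[(f s).length] (enc (f s, g s)))).2.isEmpty := by
    funext s
    obtain ⟨x', y', h1, h2⟩ := iterate_strip (f s) (g s)
    rw [h1, dec_enc, Bool.eq_iff_iff]
    simp [← h2]
  rw [e]
  exact h2

/-- Such words act as unary clocks and counters. Sums are concatenations, and multiplication by the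
variable prepends a word once for each letter of `s`. -/
theorem FP.exists_length_eq (p : Polynomial ℕ) :
    ∃ f : Str → Str, FP f ∧ ∀ s, (f s).length = p.eval s.length := by
  induction p using Polynomial.induction_on with
  | C a => exact ⟨_, .const (List.replicate a true), by simp⟩
  | add p q hp hq =>
    obtain ⟨f, hf, hf'⟩ := hp
    obtain ⟨g, hg, hg'⟩ := hq
    exact ⟨_, hf.append hg, by simp [hf', hg']⟩
  | monomial n a h =>
    obtain ⟨f, hf, hf'⟩ := h
    let step : Str → Str := fun u => enc ((dec u).1, (dec u).1 ++ (dec u).2)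
    have hstep : FP step := .pair .fst (.append .fst .snd)
    have key : ∀ n x y, (dec (step^[n] (enc (x, y)))).1 = x ∧
        (dec (step^[n] (enc (x, y)))).2.length = n * x.length + y.length ∧
        (step^[n] (enc (x, y))).length = 2 * x.length + (n * x.length + y.length) + 1 := by
      intro n
      induction n with
      | zero => intro x y; simp
      | succ n ih =>
        intro x y
        have : step (enc (x, y)) = enc (x, x ++ y) := by simp [step]
        rw [iterate_succ_apply, this]
        obtain ⟨h1, h2, h3⟩ := ih x (x ++ y)
        refine ⟨h1, ?_, ?_⟩
        · rw [h2, List.length_append]; ring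
        · rw [h3, List.length_append]; ring
    refine ⟨_, FP.snd.comp (FP.repeat .id (.pair hf (.const [])) hstep (.X + .X * .X)
      fun s n hn => ?_), fun s => ?_⟩
    · have h1 := (key n (f s) []).2.2
      have h2 : n * (f s).length ≤ (s.length + (enc (f s, [])).length) *
          (s.length + (enc (f s, [])).length) :=
        Nat.mul_le_mul (by omega) (by simp; omega)
      simp only [length_enc, List.length_nil, Polynomial.eval_add, Polynomial.eval_mul,
        Polynomial.eval_X] at h1 h2 ⊢
      omega
    · rw [(key _ _ _).2.1, hf']
      simp only [List.length_nil, Polynomial.eval_mul, Polynomial.eval_C, Polynomial.eval_pow,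
        Polynomial.eval_X]
      ring

theorem polyTime_code_iff {α β A B : Type} {ea : α → List A} {eb : β → List B} {f : α → β} :
    PolyTime ea eb f ↔ PolyTime ea id fun a => eb (f a) := by
  rw [polyTime_iff, polyTime_iff]
  rfl

theorem FB_iff {c : Str → Bool} : FB c ↔ PolyTime id Computability.encodeBool c :=
  (polyTime_code_iff (eb := Computability.encodeBool) (f := c)).symm

theorem classP_subset_classNP : classP ⊆ classNP := by
  rintro L ⟨f, hf, hL⟩
  exact ⟨fun q => f q.1, 0, hf.comp polyTime_fst,
    fun x => ⟨fun hx => ⟨[], by simp, (hL x).1 hx⟩, fun ⟨_, _, h⟩ => (hL x).2 h⟩⟩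

/-! ### From a hard language to a one-way function -/

section Construction

/-- The value at the query `1x` and the possible witness `01w`. -/
def judge (V : Str → Str → Bool) (a b : Str) : Str :=
  if a.head? == some true && (b.head? == some false && (b.tail.head? == some true &&
    V a.tail b.tail.tail)) then false :: false :: a.tail else []

/-- The products of queries with their witnesses; all other products are trivial. -/
def product (V : Str → Str → Bool) (a b : Str) : Str :=
  if a.head? == some true then judge V a b else judge V b a

variable {V : Str → Str → Bool}

theorem judge_ne_nil {a b : Str} (h : judge V a b ≠ []) :
    ∃ x w, V x w = true ∧ judge V a b = false :: false :: x ∧ a = true :: x ∧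
      b = false :: true :: w := by
  unfold judge at h ⊢
  rcases a with _ | ⟨_ | _, x⟩ <;> rcases b with _ | ⟨_ | _, _ | ⟨_ | _, w⟩⟩ <;> simp_all

theorem product_ne_nil {a b : Str} (h : product V a b ≠ []) :
    ∃ x w, V x w = true ∧ product V a b = false :: false :: x ∧
      ((a = true :: x ∧ b = false :: true :: w) ∨ (b = true :: x ∧ a = false :: true :: w)) := by
  unfold product at h ⊢
  split_ifs at h ⊢
  · obtain ⟨x, w, h1, h2, h3, h4⟩ := judge_ne_nil h
    exact ⟨x, w, h1, h2, .inl ⟨h3, h4⟩⟩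
  · obtain ⟨x, w, h1, h2, h3, h4⟩ := judge_ne_nil h
    exact ⟨x, w, h1, h2, .inr ⟨h3, h4⟩⟩

/-- If exactly one factor begins with `1`, it is the query in either order; otherwise both sides are
empty. -/
theorem product_comm (a b : Str) : product V a b = product V b a := by
  unfold product judge
  rcases a with _ | ⟨_ | _, x⟩ <;> rcases b with _ | ⟨_ | _, w⟩ <;> simp

theorem product_witness {x w : Str} (h : V x w = true) :
    product V (true :: x) (false :: true :: w) = false :: false :: x := by
  simp [product, judge, h]

/-- A product is empty or begins with `00`, whereas a factor of a nonempty product begins with `1`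
or `01`. -/
theorem product_product (a b c : Str) : product V (product V a b) c = [] := by
  by_contra h
  obtain ⟨x, w, -, -, h1⟩ := product_ne_nil h
  by_cases h2 : product V a b = []
  · simp [h2] at h1
  · obtain ⟨x', w', -, h3, -⟩ := product_ne_nil h2
    simp [h3] at h1

theorem product_nil_nil : product V [] [] = [] := rfl

/-- The total binary function given by `product`. -/
def witnessFun (V : Str → Str → Bool) : BinFun := fun a b => some (product V a b)

theorem isTotal_witnessFun : IsTotal (witnessFun V) := fun _ _ => ⟨_, rfl⟩

theorem isCommutative_witnessFun : IsCommutative (witnessFun V) := fun x y => by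
  simp [extend, witnessFun, product_comm x y]

theorem isAssociative_witnessFun : IsAssociative (witnessFun V) := fun x y z => by
  simp [extend, witnessFun, product_product, product_comm x (product V y z)]

theorem polyTimeComputable_witnessFun (hV : ∀ f g, FP f → FP g → FB fun s => V (f s) (g s)) :
    PolyTimeComputable (witnessFun V) := by
  have h (f g : Str → Str) (hf : FP f) (hg : FP g) : FP fun s => judge V (f s) (g s) :=
    .ite (.and (.head (· == some true) hf) (.and (.head (· == some false) hg)
      (.and (.head (· == some true) (.tail hg)) (hV _ _ (.tail hf) (.tail (.tail hg))))))
      (.cons _ (.cons _ (.tail hf))) (.const [])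
  refine polyTime_code_iff.2 (PolyTime.of_dec ?_)
  exact FP.cons true (.ite (.head (· == some true) .fst) (h _ _ .fst .snd) (h _ _ .snd .fst))

theorem isHonest_witnessFun (p : Polynomial ℕ)
    (hV : ∀ x w, V x w = true → w.length ≤ p.eval x.length) : IsHonest (witnessFun V) := by
  -- The `3` pays for the tags `1` and `01`.
  refine ⟨.X + p + 3, ?_⟩
  rintro z ⟨a, b, h⟩
  obtain rfl : product V a b = z := by simpa [witnessFun] using h
  by_cases h0 : product V a b = []
  · exact ⟨[], [], by simp [witnessFun, h0, product_nil_nil], by simp⟩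
  · obtain ⟨x, w, h1, h2, -⟩ := product_ne_nil h0
    refine ⟨true :: x, false :: true :: w, by rw [witnessFun, product_witness h1, h2], ?_⟩
    have h3 := hV x w h1
    have h4 := eval_mono p (show x.length ≤ (product V a b).length by simp [h2]; omega)
    simp only [h2, List.length_cons, Polynomial.eval_add, Polynomial.eval_X,
      Polynomial.eval_ofNat] at h4 ⊢
    omega

variable {L : Set Str} (hL : ∀ x, x ∈ L ↔ ∃ w, V x w = true)
  (hV : ∀ f g, FP f → FP g → FB fun s => V (f s) (g s))

include hL hV in
-- Running `V` on the proposed witness decides membership: a false proposal is rejected for every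
-- `x` outside `L`.
theorem mem_classP_of_findWitness {W : Str → Str} (hW : FP W) (h : ∀ x ∈ L, V x (W x) = true) :
    L ∈ classP :=
  ⟨fun x => V x (W x), FB_iff.1 (hV _ _ .id hW), fun x => ⟨h x, fun h => (hL x).2 ⟨_, h⟩⟩⟩

include hL hV in
theorem not_isFPInvertible_witnessFun (hP : L ∉ classP) : ¬ IsFPInvertible (witnessFun V) := by
  rintro ⟨g, hg, h⟩
  have hz : FP fun x => false :: false :: x := .cons _ (.cons _ .id)
  have h1 : FP fun x => (g (false :: false :: x)).1 :=
    (PolyTime.comp polyTime_fst hg : FP fun z => (g z).1).comp hz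
  have h2 : FP fun x => (g (false :: false :: x)).2 :=
    (PolyTime.comp polyTime_snd hg : FP fun z => (g z).2).comp hz
  refine hP (mem_classP_of_findWitness hL hV
    -- The component that begins with `1` is the query; the other is `01w`, and two tails remove its
    -- tag.
    (FP.ite (.head (· == some true) h1) (.tail (.tail h2)) (.tail (.tail h1))) fun x hx => ?_)
  obtain ⟨w, hw⟩ := (hL x).1 hx
  have h3 := h _ ⟨_, _, congrArg some (product_witness hw)⟩
  simp only [witnessFun, Option.some.injEq] at h3
  obtain ⟨x', w', h4, h5, h6⟩ := product_ne_nil (V := V) (by rw [h3]; simp)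
  obtain rfl : x = x' := by simpa [h3] using h5
  rcases h6 with ⟨h6, h7⟩ | ⟨h6, h7⟩ <;> simpa [h6, h7] using h4

include hL hV in
-- The given argument is the query `1x`, so the missing one must be a tagged witness. Commutativity
-- reduces both sides to the same claim.
theorem isStrong_witnessFun (hP : L ∉ classP) : IsStrong (witnessFun V) := by
  have key (g : Str × Str → Str) (hg : PolyTime pairCode id g)
      (h : ∀ x w, V x w = true → product V (true :: x) (g (true :: x, false :: false :: x)) =
        false :: false :: x) : False := by
    refine hP (mem_classP_of_findWitness hL hV (W := fun x =>
      (g (true :: x, false :: false :: x)).tail.tail) (.tail (.tail (hg.comp_pair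
        (.cons _ .id) (.cons _ (.cons _ .id))))) fun x hx => ?_)
    obtain ⟨w, hw⟩ := (hL x).1 hx
    have h3 := h x w hw
    obtain ⟨x', w', h4, h5, h6⟩ := product_ne_nil (V := V) (by rw [h3]; simp)
    obtain rfl : x = x' := by simpa [h3] using h5
    rcases h6 with ⟨h6, h7⟩ | ⟨h6, h7⟩
    · simpa [h7] using h4
    · simp at h7
  constructor
  · rintro ⟨g, hg, h⟩
    refine key g hg fun x w hw => ?_
    have h1 : witnessFun V (true :: x) (false :: true :: w) = some (false :: false :: x) :=
      congrArg some (product_witness hw)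
    exact Option.some.inj (h _ ⟨_, _, h1⟩ _ ⟨_, h1⟩)
  · rintro ⟨g, hg, h⟩
    refine key g hg fun x w hw => ?_
    have h1 : witnessFun V (false :: true :: w) (true :: x) = some (false :: false :: x) :=
      congrArg some ((product_comm _ _).trans (product_witness hw))
    exact (product_comm _ _).trans (Option.some.inj (h _ ⟨_, _, h1⟩ _ ⟨_, h1⟩))

end Construction

theorem exists_strong_total_commutative_AOWF (h : classP ≠ classNP) :
    ∃ σ, IsStrong σ ∧ IsTotal σ ∧ IsCommutative σ ∧ IsAOWF σ := by
  obtain ⟨L, ⟨R, p, hR, hL⟩, hP⟩ := Set.exists_of_ssubset (classP_subset_classNP.ssubset_of_ne h)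
  -- The length bound becomes part of the verifier, which makes honesty automatic.
  let V : Str → Str → Bool := fun x w => R (x, w) && (w.drop (p.eval x.length)).isEmpty
  have hLV : ∀ x, x ∈ L ↔ ∃ w, V x w = true := fun x => by simp [hL, V, and_comm]
  have hV : ∀ f g, FP f → FP g → FB fun s => V (f s) (g s) := fun f g hf hg => by
    obtain ⟨N, hN, hN'⟩ := FP.exists_length_eq p
    have h1 := FB.isEmpty (.drop (hN.comp hf) hg)
    simp only [hN'] at h1
    exact .and (FB_iff.2 (hR.comp_pair hf hg)) h1
  exact ⟨witnessFun V, isStrong_witnessFun hLV hV hP, isTotal_witnessFun,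
    isCommutative_witnessFun, isAssociative_witnessFun,
    isHonest_witnessFun p fun x w hw => by simpa using (Bool.and_eq_true_iff.1 hw).2,
    polyTimeComputable_witnessFun hV, not_isFPInvertible_witnessFun hLV hV hP⟩

/-! ### Inversion by prefix search -/

/-- Search states: unary bound, prefix that was found, value. -/
def searchState (k s z : Str) : Str := enc (k, enc (s, z))

@[simp] theorem length_searchState (k s z : Str) :
    (searchState k s z).length = 2 * k.length + 2 * s.length + z.length + 2 := by
  simp [searchState]; ring

/-- Extend the prefix by one letter that the oracle `f` approves. -/
def searchStep (f : Str → Bool) (u : Str) : Str :=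
  let next (b : Bool) := enc ((dec u).1.tail, enc ((dec (dec u).2).1 ++ [b], (dec (dec u).2).2))
  if f (next false) then next false else if f (next true) then next true else u

theorem searchStep_searchState (f : Str → Bool) (k s z : Str) :
    searchStep f (searchState k s z) =
      if f (searchState k.tail (s ++ [false]) z) then searchState k.tail (s ++ [false]) z
      else if f (searchState k.tail (s ++ [true]) z) then searchState k.tail (s ++ [true]) z
      else searchState k s z := by
  simp only [searchStep, searchState, dec_enc]
  rfl

theorem FP.searchStep {f : Str → Bool} (hf : FB f) : FP (searchStep f) := by
  have h (b : Bool) : FP fun u =>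
      enc ((dec u).1.tail, enc ((dec (dec u).2).1 ++ [b], (dec (dec u).2).2)) :=
    .pair (.tail .fst) (.pair (.append (FP.fst.comp .snd) (.const [b])) (FP.snd.comp .snd))
  exact .ite (FP.comp (f := fun s => [f s]) hf (h false)) (h false)
    (.ite (FP.comp (f := fun s => [f s]) hf (h true)) (h true) .id)

section Search

variable {S : Str → Str} {f : Str → Bool} (hf : ∀ k s z, f (searchState k s z) = true ↔
  ∃ w : Str, w.length < k.length ∧ S (s ++ w) = true :: z)

include hf

/-- An accepted letter moves one unit from the counter to the prefix, and the code counts both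
twice. The constant length is the bound that `FP.repeat` requires. -/
theorem length_iterate_searchStep (n : ℕ) (k s z : Str) :
    ((searchStep f)^[n] (searchState k s z)).length = (searchState k s z).length := by
  induction n generalizing k s with
  | zero => rfl
  | succ n ih =>
    have h (b : Bool) (hb : f (searchState k.tail (s ++ [b]) z) = true) :
        (searchState k.tail (s ++ [b]) z).length = (searchState k s z).length := by
      obtain ⟨w, hw, -⟩ := (hf _ _ _).1 hb
      simp only [length_searchState, List.length_tail, List.length_append,
        List.length_singleton] at hw ⊢
      omega
    rw [iterate_succ_apply, searchStep_searchState]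
    split_ifs with h1 h2
    · rw [ih, h _ h1]
    · rw [ih, h _ h2]
    · exact ih _ _

/-- Approval is preserved by every extension. If neither letter is approved, the promised completion
is empty, so the prefix is already a solution and the state is fixed. An approved state has a
nonempty counter, so the search must settle before the counter runs out. -/
theorem iterate_searchStep (n : ℕ) (k s z : Str) (hk : k.length = n)
    (h : f (searchState k s z) = true) :
    ∃ k' s', (searchStep f)^[n] (searchState k s z) = searchState k' s' z ∧
      S s' = true :: z := by
  induction n generalizing k s with
  | zero =>
    obtain ⟨w, hw, -⟩ := (hf _ _ _).1 h
    omega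
  | succ n ih =>
    have e := searchStep_searchState f k s z
    split_ifs at e with h1 h2
    · rw [iterate_succ_apply, e]
      exact ih _ _ (by simp [hk]) h1
    · rw [iterate_succ_apply, e]
      exact ih _ _ (by simp [hk]) h2
    · refine ⟨k, s, iterate_fixed e _, ?_⟩
      obtain ⟨w, hw, hS⟩ := (hf _ _ _).1 h
      rcases w with _ | ⟨b, w⟩
      · simpa using hS
      · have h3 : f (searchState k.tail (s ++ [b]) z) = true :=
          (hf _ _ _).2 ⟨w, by simp at hw ⊢; omega, by simpa using hS⟩
        cases b <;> contradiction

end Search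

theorem isFPInvertible_of_classP_eq_classNP (h : classP = classNP) {σ : BinFun}
    (hσ : IsHonest σ) (hσ' : PolyTimeComputable σ) : IsFPInvertible σ := by
  obtain ⟨p, hp⟩ := hσ
  let S : Str → Str := fun s => partialCode (σ (dec s).1 (dec s).2)
  have hS : FP S := polyTime_code_iff.1 (hσ'.comp polyTime_dec)
  -- The first conjunct says that the witness is strictly shorter than the unary counter.
  let R : Str × Str → Bool := fun q =>
    !((dec q.1).1.drop q.2.length).isEmpty &&
      decide (S ((dec (dec q.1).2).1 ++ q.2) = true :: (dec (dec q.1).2).2)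
  have hR : PolyTime pairCode Computability.encodeBool R := by
    have h1 := FP.fst.comp .fst
    have h2 := FP.snd.comp .fst
    exact PolyTime.of_dec (FB_iff.1 (.and (.not (.isEmpty (.drop .snd h1)))
      (.eq (hS.comp (.append (FP.fst.comp h2) .snd)) (.cons true (FP.snd.comp h2)))))
  obtain ⟨f, hf, hfA⟩ : {u | ∃ w : Str, w.length ≤ (Polynomial.X : Polynomial ℕ).eval u.length ∧
      R (u, w) = true} ∈ classP := h ▸ ⟨R, .X, hR, fun _ => Iff.rfl⟩
  have hf' : ∀ k s z, f (searchState k s z) = true ↔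
      ∃ w : Str, w.length < k.length ∧ S (s ++ w) = true :: z := by
    intro k s z
    rw [← hfA]
    simp only [R, searchState, dec_enc, Set.mem_ofPred_eq, Polynomial.eval_X, length_enc]
    refine exists_congr fun w => ?_
    simp only [Bool.and_eq_true, Bool.not_eq_true', List.isEmpty_eq_false_iff, ne_eq,
      List.drop_eq_nil_iff, decide_eq_true_eq, not_le]
    -- The counter is part of the state, so the witness bound `X` follows from the condition in `R`.
    exact ⟨fun h => h.2, fun h => ⟨by omega, h⟩⟩
  -- The code of an honest preimage has length `2 * x.length + y.length + 1`, at most `2 * p + 1`,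
  -- and must be strictly shorter than the counter.
  obtain ⟨N, hN, hN'⟩ := FP.exists_length_eq (2 * p + 2)
  have h1 := FP.repeat hN (.pair hN (.pair (.const []) .id)) (FP.searchStep (FB_iff.2 hf)) .X
    fun z n _ => by
      rw [Polynomial.eval_X]
      exact (length_iterate_searchStep hf' n (N z) [] z).le.trans (Nat.le_add_left _ _)
  refine ⟨_, polyTime_dec.comp (eb := id) (FP.fst.comp (FP.snd.comp h1)), fun z hz => ?_⟩
  obtain ⟨x, y, hxy, hlen⟩ := hp z hz
  obtain ⟨k, s, h2, h3⟩ := iterate_searchStep hf' (N z).length (N z) [] z rfl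
    ((hf' _ _ _).2 ⟨enc (x, y), by simp [hN']; omega, by simp [S, hxy, partialCode]⟩)
  rw [show enc (N z, enc ([], z)) = searchState (N z) [] z from rfl, h2]
  simp only [searchState, dec_enc]
  cases h4 : σ (dec s).1 (dec s).2 with
  | none => simp [S, h4, partialCode] at h3
  | some v => simpa [S, h4, partialCode] using h3

/-! ### The equivalences -/

theorem IsAssociative.isWeaklyAssociative {σ : BinFun} (h : IsAssociative σ) :
    IsWeaklyAssociative σ := fun x y z xy yz u v hxy hyz hu hv => by
  have := h x y z
  simp only [extend, hxy, hyz, hu, hv, Option.some.injEq] at this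
  exact this.symm

end AOWF

theorem mainTheorem1 :
    List.TFAE [
      AOWF.classP ≠ AOWF.classNP,
      ∃ σ : AOWF.BinFun, AOWF.IsAwOWF σ,
      ∃ σ : AOWF.BinFun, AOWF.IsAOWF σ,
      ∃ σ : AOWF.BinFun,
        AOWF.IsStrong σ ∧ AOWF.IsTotal σ ∧ AOWF.IsCommutative σ ∧ AOWF.IsAwOWF σ,
      ∃ σ : AOWF.BinFun,
        AOWF.IsStrong σ ∧ AOWF.IsTotal σ ∧ AOWF.IsCommutative σ ∧ AOWF.IsAOWF σ] := by
  tfae_have 1 → 5 := AOWF.exists_strong_total_commutative_AOWF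
  tfae_have 5 → 4 := fun ⟨σ, h1, h2, h3, h4, h5⟩ => ⟨σ, h1, h2, h3, h4.isWeaklyAssociative, h5⟩
  tfae_have 5 → 3 := fun ⟨σ, _, _, _, h⟩ => ⟨σ, h⟩
  tfae_have 3 → 2 := fun ⟨σ, h1, h2⟩ => ⟨σ, h1.isWeaklyAssociative, h2⟩
  tfae_have 4 → 2 := fun ⟨σ, _, _, _, h⟩ => ⟨σ, h⟩
  tfae_have 2 → 1 := fun ⟨_, _, h1, h2, h3⟩ h =>
    h3 (AOWF.isFPInvertible_of_classP_eq_classNP h h1 h2)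
  tfae_finish
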